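/- Let $n\ge 1$, $k\ge 2$, $0=a_0<a_1<\dots<a_{k-1}$, $0<\alpha_0<n$ and $0<\alpha_i<1$ for $i=1,\dots,k-1$. Let $h:[0,\infty)\to[0,\infty)$ be bounded, continuous in some neighbourhood of each $a_i$, with $h(a_i)\neq 0$ for $i=0,\dots,k-1$. Let $$\varphi(|\lambda|)=\frac{h(|\lambda|)}{|\lambda|^{n-\alpha_0}}\prod_{i=1}^{k-1}\frac{1}{\bigl||\lambda|-a_i\bigr|^{1-\alpha_i}}\in L_1(\mathbb{R}^n),$$ and let $\xi(x)$, $x\in\mathbb{R}^n$, be a real-valued, measurable, mean-square continuous, homogeneous and isotropic Gaussian random field with mean zero and isotropic spectral density $\varphi$, that is, $\mathsf{E}\,\xi(x)\xi(y)=\int_{\mathbb{R}^n}e^{i\langle\lambda,x-y\rangle}\varphi(|\lambda|)\,d\lambda$. Fix $j\in\{1,\dots,k-1\}$. For $r>0$ let $f_{a_j,r}:\mathbb{R}^n\to\mathbb{R}$ be radial, essentially non-zero weight functions in $L_1(\mathbb{R}^n)\cap L_2(\mathbb{R}^n)$ such that $$\int_{\mathbb{R}^n}e^{i\langle\lambda,x\rangle}\,r^{-n}f_{a_j,r}(x)\,dx=g_{a_j}\bigl(r(|\lambda|-a_j)\bigr),\qquad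 \lambda\in\mathbb{R}^n,\ r>0,$$ where $g_{a_j}:\mathbb{R}\to\mathbb{R}$ is even and, for some constant $C$, $g_{a_j}^2(s)\le C/s$ for all $s>0$. Put $$V_{a_j}=a_j^{1-\alpha_0}\prod_{\substack{1\le i\le k-1\\ i\neq j}}|a_j-a_i|^{1-\alpha_i}.$$ Then the integrals below are well defined (the first one almost surely, as a Lebesgue integral, and the second one as the Wiener integral of a square integrable function), and the finite-dimensional distributions of the process $$X_{r,a_j}(t)=\frac{\sqrt{V_{a_j}}}{\sqrt{2h(a_j)}\,r^{n-\alpha_j/2}}\int_{\mathbb{R}^n}f_{a_j,rt}(x)\,\xi(x)\,dx,\quad t\in(0,1],\qquad X_{r,a_j}(0)=0,$$ converge weakly, as $r\to\infty$, to those of the process $$X_{a_j}(t)=t^n\int_{\mathbb{R}^n}\frac{g_{a_j}(|u|t)}{|u|^{(n-\alpha_j)/2}}\,dZ(u),\quad t\in(0,1],\qquad X_{a_j}(0)=0,$$ where $Z$ is Gaussian white noise on $\mathbb{R}^n$ with Lebesgue intensity, that is, a centred Gaussian family $Z(A)$ indexed by the Borel sets of finite Lebesgue measure, with $\mathsf{E}\,Z(A)Z(B)=|A\cap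 B|$. -/

import Mathlib

open MeasureTheory ProbabilityTheory Filter Topology
open scoped ENNReal RealInnerProductSpace

noncomputable section

/-! ### Isotropic Gaussian random fields and their spectral densities -/

/-- `ξ` is a real-valued, jointly measurable, mean-square continuous, homogeneous and isotropic
Gaussian random field on `ℝⁿ` with zero mean and covariance function `B(|x - y|)`. -/
structure IsIsotropicGaussianField {n : ℕ} {Ω : Type*} [MeasurableSpace Ω]
    (ξ : EuclideanSpace ℝ (Fin n) → Ω → ℝ) (B : ℝ → ℝ) (P : Measure Ω) : Prop where
  measurable : Measurable (Function.uncurry ξ)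
  gaussian : IsGaussianProcess ξ P
  mean_zero : ∀ x, ∫ ω, ξ x ω ∂P = 0
  covariance_eq : ∀ x y, cov[ξ x, ξ y; P] = B ‖x - y‖
  continuous_sq_mean : ∀ x, Tendsto (fun y => ∫ ω, (ξ y ω - ξ x ω) ^ 2 ∂P) (𝓝 x) (𝓝 0)

/-- `φ` is the isotropic spectral density belonging to the covariance function `B` on `ℝⁿ`:
`λ ↦ φ(|λ|)` is integrable and `B(|x|) = ∫ e^{i⟨λ,x⟩} φ(|λ|) dλ`. -/
structure HasIsotropicSpectralDensity (n : ℕ) (B φ : ℝ → ℝ) : Prop where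
  integrable : Integrable (fun l : EuclideanSpace ℝ (Fin n) => φ ‖l‖) volume
  covariance_eq : ∀ x : EuclideanSpace ℝ (Fin n),
    ((B ‖x‖ : ℝ) : ℂ) =
      ∫ l : EuclideanSpace ℝ (Fin n), Complex.exp (Complex.I * (⟪l, x⟫ : ℝ)) * ((φ ‖l‖ : ℝ) : ℂ)

/-- `φ` is of cyclical long-range dependent form on `ℝⁿ`, with singularities at the points
`0 = a 0 < a 1 < ⋯ < a (k-1)`, exponents `α i` and bounded factor `h`. At the singular points
themselves nothing is required of the value of `φ`. -/
structure IsCyclicalDensity (n k : ℕ) (a α : ℕ → ℝ) (h φ : ℝ → ℝ) : Prop where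
  a_zero : a 0 = 0
  a_lt : ∀ i j, i < j → j < k → a i < a j
  alpha_zero : 0 < α 0 ∧ α 0 < n
  alpha_pos_lt : ∀ i ∈ Finset.Ico 1 k, 0 < α i ∧ α i < 1
  h_nonneg : ∀ s, 0 ≤ s → 0 ≤ h s
  h_bounded : ∃ M, ∀ s, 0 ≤ s → h s ≤ M
  h_continuous : ∀ i < k, ∃ U ∈ 𝓝[Set.Ici 0] (a i), ContinuousOn h U
  h_ne_zero : ∀ i < k, h (a i) ≠ 0
  eq_formula : ∀ s, 0 ≤ s → (∀ i < k, s ≠ a i) →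
    φ s = h s / s ^ ((n : ℝ) - α 0) * ∏ i ∈ Finset.Ico 1 k, 1 / |s - a i| ^ (1 - α i)
  integrable : Integrable (fun l : EuclideanSpace ℝ (Fin n) => φ ‖l‖) volume

/-- The constant `a_j^{1-α₀} ∏_{i ≠ j} |a_j - a_i|^{1-α_i}`, `i` running over `1, …, k-1`. -/
def cyclicalConst (k : ℕ) (a α : ℕ → ℝ) (j : ℕ) : ℝ :=
  a j ^ (1 - α 0) * ∏ i ∈ (Finset.Ico 1 k).erase j, |a j - a i| ^ (1 - α i)

/-! ### Weight functions -/

/-- `(f r)_{r > 0}` is a family of radial, essentially non-zero weight functions on `ℝⁿ`, lying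
in `L¹ ∩ L²`, such that the Fourier transform `λ ↦ ∫ e^{i⟨λ,x⟩} r⁻ⁿ f_r(x) dx` is
`g (r (|λ| - c))`, with `g` even and `g(s)² ≤ C / s` for `s > 0`. -/
structure IsWeightFamily (n : ℕ) (c : ℝ) (f : ℝ → EuclideanSpace ℝ (Fin n) → ℝ) (g : ℝ → ℝ) :
    Prop where
  radial : ∀ r, 0 < r → ∀ x y, ‖x‖ = ‖y‖ → f r x = f r y
  essentially_ne_zero : ∀ r, 0 < r → ¬ (f r =ᵐ[volume] 0)
  memLp_one : ∀ r, 0 < r → MemLp (f r) 1 volume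
  memLp_two : ∀ r, 0 < r → MemLp (f r) 2 volume
  fourier_eq : ∀ r, 0 < r → ∀ l : EuclideanSpace ℝ (Fin n),
    ∫ x, Complex.exp (Complex.I * (⟪l, x⟫ : ℝ)) * ((f r x / r ^ n : ℝ) : ℂ)
      = ((g (r * (‖l‖ - c)) : ℝ) : ℂ)
  even : ∀ s, g (-s) = g s
  decay : ∃ C, ∀ s, 0 < s → g s ^ 2 ≤ C / s

/-! ### Gaussian white noise and the Wiener integral -/

/-- The measurable sets of finite measure. -/
abbrev FinMeasSet {X : Type*} [MeasurableSpace X] (μ : Measure X) : Type _ :=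
  {A : Set X // MeasurableSet A ∧ μ A ≠ ∞}

/-- `Z` is a Gaussian white noise with intensity `μ`: a centred Gaussian family indexed
by the measurable sets of finite measure, with `E[Z(A) Z(B)] = μ(A ∩ B)`. -/
structure IsWhiteNoise {X : Type*} [MeasurableSpace X] (μ : Measure X)
    {Ω : Type*} [MeasurableSpace Ω] (Z : FinMeasSet μ → Ω → ℝ) (P : Measure Ω) : Prop where
  gaussian : IsGaussianProcess Z P
  mean_zero : ∀ A, ∫ ω, Z A ω ∂P = 0
  covariance_eq : ∀ A B : FinMeasSet μ,
    ∫ ω, Z A ω * Z B ω ∂P = μ.real ((A : Set X) ∩ (B : Set X))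

/-- The linear combination `∑ c_A 1_A` in `L²(μ)`. -/
def indicatorComb {X : Type*} [MeasurableSpace X] (μ : Measure X) :
    (FinMeasSet μ →₀ ℝ) →ₗ[ℝ] Lp ℝ 2 μ :=
  Finsupp.linearCombination ℝ fun A => indicatorConstLp 2 A.2.1 A.2.2 (1 : ℝ)

namespace IsWhiteNoise

variable {X : Type*} [MeasurableSpace X] {μ : Measure X}
  {Ω : Type*} [MeasurableSpace Ω] {Z : FinMeasSet μ → Ω → ℝ} {P : Measure Ω}

lemma memLp (hZ : IsWhiteNoise μ Z P) (A : FinMeasSet μ) : MemLp (Z A) 2 P :=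
  (hZ.gaussian.hasGaussianLaw_eval A).memLp_two

/-- The linear combination `∑ c_A Z(A)` in `L²(P)`. -/
def noiseComb (hZ : IsWhiteNoise μ Z P) : (FinMeasSet μ →₀ ℝ) →ₗ[ℝ] Lp ℝ 2 P :=
  Finsupp.linearCombination ℝ fun A => (hZ.memLp A).toLp (Z A)

/-- The Wiener integral `f ↦ ∫ f dZ` on `L²(μ)`: the continuous linear extension of
`∑ c_A 1_A ↦ ∑ c_A Z(A)`. -/
def integralL2 (hZ : IsWhiteNoise μ Z P) : Lp ℝ 2 μ →L[ℝ] Lp ℝ 2 P :=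
  hZ.noiseComb.extendOfNorm (indicatorComb μ)

open scoped Classical in
/-- The Wiener integral `∫ f dZ` of a function `f`, which is meaningful for `f` square integrable
(and is set to `0` otherwise). -/
def integral (hZ : IsWhiteNoise μ Z P) (f : X → ℝ) : Ω → ℝ :=
  if hf : MemLp f 2 μ then ⇑(hZ.integralL2 (hf.toLp f)) else 0

lemma norm_noiseComb (hZ : IsWhiteNoise μ Z P) (c : FinMeasSet μ →₀ ℝ) :
    ‖hZ.noiseComb c‖ = ‖indicatorComb μ c‖ := by
  have key : ∀ A B : FinMeasSet μ,
      ⟪(hZ.memLp A).toLp (Z A), (hZ.memLp B).toLp (Z B)⟫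
        = ⟪indicatorConstLp 2 A.2.1 A.2.2 (1 : ℝ), indicatorConstLp 2 B.2.1 B.2.2 (1 : ℝ)⟫ := by
    intro A B
    rw [L2.inner_indicatorConstLp_indicatorConstLp A.2.1 B.2.1 A.2.2 B.2.2, L2.inner_def]
    have : ∫ ω, ⟪(hZ.memLp A).toLp (Z A) ω, (hZ.memLp B).toLp (Z B) ω⟫ ∂P
        = ∫ ω, Z A ω * Z B ω ∂P := by
      apply integral_congr_ae
      filter_upwards [(hZ.memLp A).coeFn_toLp, (hZ.memLp B).coeFn_toLp] with ω h1 h2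
      rw [h1, h2]
      simp [mul_comm]
    rw [this, hZ.covariance_eq]
    simp
  have h : ⟪hZ.noiseComb c, hZ.noiseComb c⟫ = ⟪indicatorComb μ c, indicatorComb μ c⟫ := by
    simp only [noiseComb, indicatorComb, Finsupp.linearCombination_apply, Finsupp.sum, sum_inner,
      inner_sum, inner_smul_left, inner_smul_right, key]
  rw [real_inner_self_eq_norm_sq, real_inner_self_eq_norm_sq] at h
  exact (sq_eq_sq₀ (norm_nonneg _) (norm_nonneg _)).1 h

lemma denseRange_indicatorComb (μ : Measure X) : DenseRange (indicatorComb μ) := by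
  have : ∀ f : Lp ℝ 2 μ, f ∈ (LinearMap.range (indicatorComb μ)).topologicalClosure := by
    intro f
    induction f using Lp.induction (p := 2) ENNReal.ofNat_ne_top with
    | @indicatorConst c s hs hμs =>
      apply Submodule.le_topologicalClosure
      refine ⟨Finsupp.single ⟨_, hs, hμs.ne⟩ c, ?_⟩
      rw [indicatorComb, Finsupp.linearCombination_single, Lp.simpleFunc.coe_indicatorConst]
      ext1
      filter_upwards [Lp.coeFn_smul c (indicatorConstLp 2 hs hμs.ne (1 : ℝ)),
        indicatorConstLp_coeFn (p := 2) (hs := hs) (hμs := hμs.ne) (c := (1 : ℝ)),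
        indicatorConstLp_coeFn (p := 2) (hs := hs) (hμs := hμs.ne) (c := c)] with x h1 h2 h3
      rw [h1, h3, Pi.smul_apply, h2]
      by_cases hx : x ∈ s <;> simp [Set.indicator, hx]
    | add hf hg _ h1 h2 => exact add_mem h1 h2
    | isClosed => exact Submodule.isClosed_topologicalClosure _
  intro f
  exact this f

/-- The Wiener integral of `1_A` is `Z(A)`. -/
lemma integralL2_indicator (hZ : IsWhiteNoise μ Z P) (A : FinMeasSet μ) :
    hZ.integralL2 (indicatorConstLp 2 A.2.1 A.2.2 (1 : ℝ)) = (hZ.memLp A).toLp (Z A) := by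
  have h := LinearMap.extendOfNorm_eq (f := hZ.noiseComb) (denseRange_indicatorComb μ)
    ⟨1, fun c => by rw [hZ.norm_noiseComb, one_mul]⟩ (Finsupp.single A 1)
  simpa [indicatorComb, noiseComb, integralL2] using h

/-- The Wiener integral is isometric. -/
lemma norm_integralL2 (hZ : IsWhiteNoise μ Z P) (f : Lp ℝ 2 μ) : ‖hZ.integralL2 f‖ = ‖f‖ := by
  refine (denseRange_indicatorComb μ).induction_on f (isClosed_eq (by fun_prop) (by fun_prop)) ?_
  intro c
  rw [← hZ.norm_noiseComb]
  congr 1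
  exact LinearMap.extendOfNorm_eq (f := hZ.noiseComb) (denseRange_indicatorComb μ)
    ⟨1, fun c => by rw [hZ.norm_noiseComb, one_mul]⟩ c

end IsWhiteNoise

/-! ### The processes -/

/-- The normalized weighted functional, `t ∈ [0,1]`: it is `0` at `t = 0`, and otherwise
`√V / (√(2 h_c) r^{n - β/2}) ∫ f_{rt}(x) ξ(x) dx`. -/
def prelimitProcess {n : ℕ} {Ω : Type*} (V hc β : ℝ) (f : ℝ → EuclideanSpace ℝ (Fin n) → ℝ)
    (ξ : EuclideanSpace ℝ (Fin n) → Ω → ℝ) (r t : ℝ) (ω : Ω) : ℝ :=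
  if t = 0 then 0
  else √V / (√(2 * hc) * r ^ ((n : ℝ) - β / 2)) * ∫ x, f (r * t) x * ξ x ω

/-- The kernel `u ↦ g(|u| t) / |u|^{(n-β)/2}` on `ℝⁿ`. -/
def limitKernel (n : ℕ) (β : ℝ) (g : ℝ → ℝ) (t : ℝ) (u : EuclideanSpace ℝ (Fin n)) : ℝ :=
  g (‖u‖ * t) / ‖u‖ ^ (((n : ℝ) - β) / 2)

/-- The limit process, `t ∈ [0,1]`: it is `0` at `t = 0`, and otherwise
`tⁿ ∫ g(|u| t) / |u|^{(n-β)/2} dZ(u)`. -/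
def limitProcess {n : ℕ} {Ω : Type*} [MeasurableSpace Ω] {P : Measure Ω}
    {Z : FinMeasSet (volume : Measure (EuclideanSpace ℝ (Fin n))) → Ω → ℝ}
    (hZ : IsWhiteNoise volume Z P) (β : ℝ) (g : ℝ → ℝ) (t : ℝ) (ω : Ω) : ℝ :=
  if t = 0 then 0 else t ^ n * hZ.integral (limitKernel n β g t) ω

end

/-! ### The closed span of a centred Gaussian process -/

section GaussianSpan

variable {T Ω : Type*} [MeasurableSpace Ω] {P : Measure Ω} [IsProbabilityMeasure P]

/-! Everything reduces to one variance. A linear combination `∑ c_i X_r(t_i)` is the integral of the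
field against one integrable weight, so it lies in the closed `L²` span of `ξ`; the same combination
of the limit process is one Wiener integral, in the closed span of `Z`. Elements of such spans
satisfy `E e^{iY} = e^{-‖Y‖²/2}` (`integral_cexp_of_mem_closure_span`), so by Cramér–Wold and Lévy
it suffices that the variances converge.

Put `G(s) = ∑ c_i t_i^n g(t_i s)`. By Fubini and the spectral representation the prelimit variance
is `V/(2h(a_j)) · r^{α_j} ∫ φ(|λ|) G(r(|λ| - a_j))² dλ`. In polar coordinates the radial density
`ρ^{n-1} φ(ρ)` behaves like `(h(a_j)/V) |ρ - a_j|^{α_j-1}` near `a_j`. Substituting `u = r(ρ - a_j)`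
there cancels all powers of `r`; away from `a_j` the bound `G(s)² ≤ C/|s|` leaves `O(r^{α_j-1})`,
which vanishes since `α_j < 1` (`tendsto_rpow_mul_integral_mul_sq`). As `G` is even, the two sides
of the sphere contribute equally. This yields the factor `2` in the normalization, and the limit is
`∫ |u|^{α_j-n} G(|u|)² du`, the variance of the limit combination. -/

lemma lipschitzWith_integral_cexp :
    LipschitzWith 1 (fun Y : Lp ℝ 2 P => ∫ ω, Complex.exp (Complex.I * (Y ω : ℂ)) ∂P) := by
  refine LipschitzWith.of_dist_le_mul fun Y W => ?_
  have hint : ∀ V : Lp ℝ 2 P, Integrable (fun ω => Complex.exp (Complex.I * (V ω : ℂ))) P := by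
    intro V
    refine Integrable.of_bound (C := 1) ?_ (ae_of_all _ fun ω => ?_)
    · have := (Lp.memLp V).1.aemeasurable
      exact AEMeasurable.aestronglyMeasurable (by fun_prop)
    · rw [mul_comm, Complex.norm_exp_ofReal_mul_I]
  have hdiff : MemLp (fun ω => Y ω - W ω) 2 P := (Lp.memLp Y).sub (Lp.memLp W)
  rw [dist_eq_norm, ← integral_sub (hint Y) (hint W), NNReal.coe_one, one_mul, dist_eq_norm]
  calc ‖∫ ω, (Complex.exp (Complex.I * (Y ω : ℂ)) - Complex.exp (Complex.I * (W ω : ℂ))) ∂P‖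
      ≤ ∫ ω, ‖Y ω - W ω‖ ∂P := by
        refine norm_integral_le_of_norm_le (hdiff.integrable (by norm_num)).norm
          (ae_of_all _ fun ω => ?_)
        -- `|e^{iY} - e^{iW}| = |e^{i(Y-W)} - 1| ≤ |Y - W|`; then `L¹ ≤ L²` norms on a probability
        -- space.
        have h := Real.norm_exp_I_mul_ofReal_sub_one_le (x := Y ω - W ω)
        have e : Complex.exp (Complex.I * (Y ω : ℂ)) - Complex.exp (Complex.I * (W ω : ℂ))
            = (Complex.exp (Complex.I * ((Y ω - W ω : ℝ) : ℂ)) - 1)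
              * Complex.exp ((W ω : ℝ) * Complex.I) := by
          rw [sub_mul, ← Complex.exp_add, one_mul]
          push_cast
          ring_nf
        rw [e, norm_mul, Complex.norm_exp_ofReal_mul_I, mul_one]
        exact h
    _ ≤ ‖Y - W‖ := by
        rw [← integral_congr_ae (g := fun ω => ‖Y ω - W ω‖) ae_eq_rfl,
          integral_norm_eq_lintegral_enorm hdiff.1, Lp.norm_def]
        have h1 : eLpNorm (Y - W : Lp ℝ 2 P) 2 P = eLpNorm (fun ω => Y ω - W ω) 2 P :=
          eLpNorm_congr_ae (Lp.coeFn_sub Y W)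
        rw [h1, ← eLpNorm_one_eq_lintegral_enorm]
        exact ENNReal.toReal_mono hdiff.2.ne
          (eLpNorm_le_eLpNorm_of_exponent_le (by norm_num) hdiff.1)

/-- An element `Y` of the closed span in `L²` of a centred Gaussian process satisfies
`E e^{iY} = e^{-‖Y‖²/2}`. -/
lemma integral_cexp_of_mem_closure_span {X : T → Ω → ℝ} (hX : IsGaussianProcess X P)
    (h0 : ∀ t, ∫ ω, X t ω ∂P = 0) (h2 : ∀ t, MemLp (X t) 2 P) {Y : Lp ℝ 2 P}
    (hY : Y ∈ (Submodule.span ℝ (Set.range fun t => (h2 t).toLp (X t))).topologicalClosure) :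
    ∫ ω, Complex.exp (Complex.I * (Y ω : ℂ)) ∂P = Complex.exp (-((‖Y‖ ^ 2 / 2 : ℝ) : ℂ)) := by
  -- The identity is a closed condition in `L²`, so only finite linear combinations, which are
  -- Gaussian, need checking.
  have hcl : IsClosed {Y : Lp ℝ 2 P | ∫ ω, Complex.exp (Complex.I * (Y ω : ℂ)) ∂P
      = Complex.exp (-((‖Y‖ ^ 2 / 2 : ℝ) : ℂ))} :=
    isClosed_eq lipschitzWith_integral_cexp.continuous (by fun_prop)
  refine closure_minimal ?_ hcl hY
  intro W hW
  obtain ⟨c, hc⟩ := Finsupp.mem_span_range_iff_exists_finsupp.1 hW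
  have hae : W =ᵐ[P] fun ω => ∑ t ∈ c.support, c t • X t ω := by
    rw [← hc, Finsupp.sum]
    refine (Lp.coeFn_finsetSum _ _).trans ?_
    have : ∀ t ∈ c.support, ∀ᵐ ω ∂P, (c t • (h2 t).toLp (X t) : Lp ℝ 2 P) ω = c t • X t ω := by
      intro t _
      filter_upwards [Lp.coeFn_smul (c t) ((h2 t).toLp (X t)), (h2 t).coeFn_toLp] with ω h1 h3
      rw [h1, Pi.smul_apply, h3]
    filter_upwards [(Finset.eventually_all c.support).2 this] with ω hω
    rw [Finset.sum_apply]
    exact Finset.sum_congr rfl hω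
  have hg : HasGaussianLaw W P :=
    ((hX.smul c).hasGaussianLaw_fun_sum (I := c.support)).congr hae.symm
  have hmean : ∫ ω, W ω ∂P = 0 := by
    rw [integral_congr_ae hae, integral_finsetSum]
    · simp [integral_const_mul, h0]
    · exact fun t _ => ((h2 t).integrable (by norm_num)).smul (c t)
  have hvar : Var[W; P] = ‖W‖ ^ 2 := by
    rw [variance_of_integral_eq_zero hg.aemeasurable hmean, ← real_inner_self_eq_norm_sq,
      L2.inner_def]
    refine integral_congr_ae (ae_of_all _ fun ω => ?_)
    simp [pow_two]
  have h1 : charFun (P.map W) 1 = ∫ ω, Complex.exp (Complex.I * (W ω : ℂ)) ∂P := by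
    rw [charFun_apply_real, integral_map hg.aemeasurable (by fun_prop)]
    simp [mul_comm]
  show ∫ ω, Complex.exp (Complex.I * (W ω : ℂ)) ∂P = _
  rw [← h1, hg.map_eq_gaussianReal, charFun_gaussianReal, hmean, hvar]
  simp

end GaussianSpan

/-! ### Characteristic functions and convergence of random vectors -/

lemma charFun_map_euclideanSpace {Ω : Type*} [MeasurableSpace Ω] {P : Measure Ω} {m : ℕ}
    {V : Ω → Fin m → ℝ} (hV : AEMeasurable V P) (c : EuclideanSpace ℝ (Fin m)) :
    charFun (P.map fun ω => (EuclideanSpace.equiv (Fin m) ℝ).symm (V ω)) c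
      = ∫ ω, Complex.exp (Complex.I * ((∑ i, c i * V ω i : ℝ) : ℂ)) ∂P := by
  have hV' : AEMeasurable (fun ω => (EuclideanSpace.equiv (Fin m) ℝ).symm (V ω)) P :=
    (EuclideanSpace.equiv (Fin m) ℝ).symm.continuous.measurable.comp_aemeasurable hV
  rw [charFun_apply, integral_map hV' (Continuous.aestronglyMeasurable (by fun_prop))]
  refine integral_congr_ae (ae_of_all _ fun ω => ?_)
  simp only [PiLp.inner_apply]
  rw [mul_comm]
  simp

/-- The **Cramér–Wold** form of Lévy's convergence theorem for random vectors. -/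
lemma tendstoInDistribution_of_tendsto_integral_cexp {ι Ω Ω' : Type*} {l : Filter ι}
    [l.IsCountablyGenerated] [MeasurableSpace Ω] [MeasurableSpace Ω'] {P : Measure Ω}
    [IsProbabilityMeasure P] {P' : Measure Ω'} [IsProbabilityMeasure P'] {m : ℕ}
    {X : ι → Ω → Fin m → ℝ} {Y : Ω' → Fin m → ℝ}
    (hX : ∀ r, AEMeasurable (X r) P) (hY : AEMeasurable Y P')
    (h : ∀ c : Fin m → ℝ,
      Tendsto (fun r => ∫ ω, Complex.exp (Complex.I * ((∑ i, c i * X r ω i : ℝ) : ℂ)) ∂P) l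
        (𝓝 (∫ ω, Complex.exp (Complex.I * ((∑ i, c i * Y ω i : ℝ) : ℂ)) ∂P'))) :
    TendstoInDistribution X l Y (fun _ => P) P' := by
  -- Characteristic functions use an inner product, so the vectors are moved to Euclidean space and
  -- back by a homeomorphism.
  let e := (EuclideanSpace.equiv (Fin m) ℝ)
  have hmeas : Measurable e.symm := e.symm.continuous.measurable
  have key : TendstoInDistribution (fun r ω => e.symm (X r ω)) l (fun ω => e.symm (Y ω))
      (fun _ => P) P' := by
    refine ⟨fun r => hmeas.comp_aemeasurable (hX r), hmeas.comp_aemeasurable hY, ?_⟩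
    refine tendsto_of_seq_tendsto fun u hu => ?_
    refine ProbabilityMeasure.tendsto_of_tendsto_charFun fun c => ?_
    have h1 := (h c).comp hu
    simp only [ProbabilityMeasure.coe_mk]
    rw [charFun_map_euclideanSpace hY]
    refine h1.congr fun k => ?_
    exact (charFun_map_euclideanSpace (hX (u k)) c).symm
  exact key.continuous_comp e.continuous

/-! ### Lebesgue integrals of an isotropic Gaussian field -/

/-- Tonelli: a bound on the `L¹(P)` norms of `H (x, ·)` uniform in `x` leaves only `F` to be
integrated. This licenses every use of Fubini with the field. -/
lemma integrable_mul_prod_of_integral_norm_le {X Ω : Type*} [MeasurableSpace X]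
    [MeasurableSpace Ω] {μ : Measure X} [SFinite μ] {P : Measure Ω} [SFinite P] {F : X → ℝ}
    (hF : Integrable F μ) {H : X × Ω → ℝ} (hH : AEStronglyMeasurable H (μ.prod P))
    (hHx : ∀ x, Integrable (fun ω => H (x, ω)) P) {C : ℝ} (hC : ∀ x, ∫ ω, ‖H (x, ω)‖ ∂P ≤ C) :
    Integrable (fun z : X × Ω => F z.1 * H z) (μ.prod P) := by
  have hm : AEStronglyMeasurable (fun z : X × Ω => F z.1 * H z) (μ.prod P) := hF.1.comp_fst.mul hH
  refine (integrable_prod_iff hm).2 ⟨ae_of_all _ fun x => (hHx x).const_mul (F x), ?_⟩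
  refine Integrable.mono' (hF.norm.mul_const C) hm.norm.integral_prod_right'
    (ae_of_all _ fun x => ?_)
  simp only [norm_mul, integral_const_mul]
  rw [norm_norm, Real.norm_of_nonneg (integral_nonneg fun _ => norm_nonneg _)]
  exact mul_le_mul_of_nonneg_left (hC x) (norm_nonneg _)

lemma integral_mul_sq_eq {n : ℕ} {Ω : Type*} (ξ : EuclideanSpace ℝ (Fin n) → Ω → ℝ)
    (F : EuclideanSpace ℝ (Fin n) → ℝ) (ω : Ω) :
    (∫ x, F x * ξ x ω) ^ 2 = ∫ z : EuclideanSpace ℝ (Fin n) × EuclideanSpace ℝ (Fin n),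
      (F z.1 * F z.2) * (ξ z.1 ω * ξ z.2 ω) ∂(volume.prod volume) := by
  rw [pow_two, ← integral_prod_mul]
  congr 1 with z
  ring

namespace IsIsotropicGaussianField

variable {n : ℕ} {Ω : Type*} [MeasurableSpace Ω] {P : Measure Ω}
  {ξ : EuclideanSpace ℝ (Fin n) → Ω → ℝ} {B : ℝ → ℝ}

lemma memLp (hξ : IsIsotropicGaussianField ξ B P) (x : EuclideanSpace ℝ (Fin n)) :
    MemLp (ξ x) 2 P :=
  (hξ.gaussian.hasGaussianLaw_eval x).memLp_two

variable [IsProbabilityMeasure P]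

lemma integral_mul (hξ : IsIsotropicGaussianField ξ B P) (x y : EuclideanSpace ℝ (Fin n)) :
    ∫ ω, ξ x ω * ξ y ω ∂P = B ‖x - y‖ := by
  have h := hξ.covariance_eq x y
  rw [covariance_eq_sub (hξ.memLp x) (hξ.memLp y), hξ.mean_zero, zero_mul, sub_zero] at h
  exact h

/-- From `2|ξW| ≤ ξ² + W²`; by homogeneity `E ξ(x)² = B 0`, so the bound does not depend on `x`. -/
lemma integral_norm_mul_le (hξ : IsIsotropicGaussianField ξ B P)
    (x : EuclideanSpace ℝ (Fin n)) {W : Ω → ℝ} (hW : MemLp W 2 P) :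
    ∫ ω, ‖ξ x ω * W ω‖ ∂P ≤ (B 0 + ∫ ω, W ω ^ 2 ∂P) / 2 := by
  have h1 := (hξ.memLp x).integrable_sq
  have h2 := hW.integrable_sq
  have h3 : ∫ ω, ξ x ω ^ 2 ∂P = B 0 := by
    have := hξ.integral_mul x x
    simpa [pow_two] using this
  rw [← h3, ← integral_add h1 h2, ← integral_div]
  refine integral_mono (MemLp.integrable_mul (hξ.memLp x) hW).norm ((h1.add h2).div_const 2)
    fun ω => ?_
  simp only [norm_mul, Real.norm_eq_abs]
  nlinarith [sq_nonneg (|ξ x ω| - |W ω|), sq_abs (ξ x ω), sq_abs (W ω)]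

variable {F : EuclideanSpace ℝ (Fin n) → ℝ}

lemma integrable_mul_mul_prod (hξ : IsIsotropicGaussianField ξ B P) (hF : Integrable F volume)
    {W : Ω → ℝ} (hW : MemLp W 2 P) :
    Integrable (fun z : EuclideanSpace ℝ (Fin n) × Ω => F z.1 * (ξ z.1 z.2 * W z.2))
      (volume.prod P) :=
  integrable_mul_prod_of_integral_norm_le hF
    (H := fun z : EuclideanSpace ℝ (Fin n) × Ω => ξ z.1 z.2 * W z.2)
    (hξ.measurable.aestronglyMeasurable.mul hW.1.comp_snd)
    (fun x => MemLp.integrable_mul (hξ.memLp x) hW) (fun x => hξ.integral_norm_mul_le x hW)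

lemma integrable_mul_prod (hξ : IsIsotropicGaussianField ξ B P) (hF : Integrable F volume) :
    Integrable (fun z : EuclideanSpace ℝ (Fin n) × Ω => F z.1 * ξ z.1 z.2) (volume.prod P) := by
  simpa using hξ.integrable_mul_mul_prod hF (memLp_const (1 : ℝ))

lemma ae_integrable_mul (hξ : IsIsotropicGaussianField ξ B P) (hF : Integrable F volume) :
    ∀ᵐ ω ∂P, Integrable (fun x => F x * ξ x ω) volume :=
  (hξ.integrable_mul_prod hF).prod_left_ae

lemma integrable_mul_mul_prod_prod (hξ : IsIsotropicGaussianField ξ B P)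
    (hF : Integrable F volume) :
    Integrable (fun z : (EuclideanSpace ℝ (Fin n) × EuclideanSpace ℝ (Fin n)) × Ω =>
      (F z.1.1 * F z.1.2) * (ξ z.1.1 z.2 * ξ z.1.2 z.2)) ((volume.prod volume).prod P) := by
  refine integrable_mul_prod_of_integral_norm_le (hF.mul_prod hF)
    (H := fun z : (EuclideanSpace ℝ (Fin n) × EuclideanSpace ℝ (Fin n)) × Ω =>
      ξ z.1.1 z.2 * ξ z.1.2 z.2) (C := (B 0 + B 0) / 2) ?_
    (fun x => MemLp.integrable_mul (hξ.memLp x.1) (hξ.memLp x.2)) fun x => ?_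
  · have h := hξ.measurable
    exact ((h.comp (f := fun z : (EuclideanSpace ℝ (Fin n) × EuclideanSpace ℝ (Fin n)) × Ω =>
      (z.1.1, z.2)) (by fun_prop)).mul (h.comp (f := fun z : (EuclideanSpace ℝ (Fin n) ×
      EuclideanSpace ℝ (Fin n)) × Ω => (z.1.2, z.2)) (by fun_prop))).aestronglyMeasurable
  · have h3 : ∫ ω, ξ x.2 ω ^ 2 ∂P = B 0 := by
      simpa [pow_two] using hξ.integral_mul x.2 x.2
    have := hξ.integral_norm_mul_le x.1 (hξ.memLp x.2)
    rwa [h3] at this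

lemma memLp_integral_mul (hξ : IsIsotropicGaussianField ξ B P) (hF : Integrable F volume) :
    MemLp (fun ω => ∫ x, F x * ξ x ω) 2 P := by
  refine (memLp_two_iff_integrable_sq (hξ.integrable_mul_prod hF).integral_prod_right.1).2 ?_
  simp_rw [integral_mul_sq_eq]
  exact (hξ.integrable_mul_mul_prod_prod hF).integral_prod_right

lemma integral_sq_integral_mul (hξ : IsIsotropicGaussianField ξ B P) (hF : Integrable F volume) :
    ∫ ω, (∫ x, F x * ξ x ω) ^ 2 ∂P
      = ∫ z : EuclideanSpace ℝ (Fin n) × EuclideanSpace ℝ (Fin n),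
        (F z.1 * F z.2) * B ‖z.1 - z.2‖ ∂(volume.prod volume) := by
  simp_rw [integral_mul_sq_eq]
  rw [← integral_integral_swap (hξ.integrable_mul_mul_prod_prod hF)]
  simp_rw [integral_const_mul, hξ.integral_mul]

/-- The integral of the field against an integrable function lies in the closed span of the
field in `L²`. -/
lemma toLp_integral_mul_mem (hξ : IsIsotropicGaussianField ξ B P) (hF : Integrable F volume) :
    (hξ.memLp_integral_mul hF).toLp _ ∈
      (Submodule.span ℝ (Set.range fun x => (hξ.memLp x).toLp (ξ x))).topologicalClosure := by
  -- Duality instead of Riemann sums: a `W` orthogonal to every `ξ x` is orthogonal to the integral,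
  -- by Fubini.
  rw [← Submodule.orthogonal_orthogonal_eq_closure, Submodule.mem_orthogonal]
  intro W hW
  have hx : ∀ x, ∫ ω, ξ x ω * W ω ∂P = 0 := by
    intro x
    have h := (Submodule.mem_orthogonal _ _).1 hW _ (Submodule.subset_span ⟨x, rfl⟩)
    rw [L2.inner_def] at h
    rw [← h]
    refine integral_congr_ae ?_
    filter_upwards [(hξ.memLp x).coeFn_toLp] with ω h1
    rw [h1]
    simp [mul_comm]
  have hint := hξ.integrable_mul_mul_prod hF (Lp.memLp W)
  rw [L2.inner_def]
  calc ∫ ω, ⟪W ω, (hξ.memLp_integral_mul hF).toLp _ ω⟫ ∂P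
      = ∫ ω, (∫ x, F x * (ξ x ω * W ω)) ∂P := by
        refine integral_congr_ae ?_
        filter_upwards [(hξ.memLp_integral_mul hF).coeFn_toLp] with ω h1
        rw [h1]
        simp only [← mul_assoc, integral_mul_const]
        simp
    _ = ∫ x, ∫ ω, F x * (ξ x ω * W ω) ∂P := (integral_integral_swap hint).symm
    _ = 0 := by simp [integral_const_mul, hx]

end IsIsotropicGaussianField

/-- Plancherel-type formula: a stationary quadratic form is an integral against the spectral
density of the squared Fourier transform. -/
lemma HasIsotropicSpectralDensity.integral_mul_mul {n : ℕ} {B φ : ℝ → ℝ}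
    (hB : HasIsotropicSpectralDensity n B φ) {F : EuclideanSpace ℝ (Fin n) → ℝ}
    (hF : Integrable F volume) {G : EuclideanSpace ℝ (Fin n) → ℝ}
    (hG : ∀ l : EuclideanSpace ℝ (Fin n),
      ∫ x, Complex.exp (Complex.I * (⟪l, x⟫ : ℝ)) * ((F x : ℝ) : ℂ) = ((G l : ℝ) : ℂ)) :
    ∫ z : EuclideanSpace ℝ (Fin n) × EuclideanSpace ℝ (Fin n),
        (F z.1 * F z.2) * B ‖z.1 - z.2‖ ∂(volume.prod volume)
      = ∫ l : EuclideanSpace ℝ (Fin n), φ ‖l‖ * G l ^ 2 := by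
  -- The transform of `F` is real, so conjugation leaves it unchanged; hence both factors of
  -- `e^{i⟨l,x⟩} e^{-i⟨l,y⟩}` produce `G l`.
  have hG' : ∀ l : EuclideanSpace ℝ (Fin n),
      ∫ x, Complex.exp (-(Complex.I * (⟪l, x⟫ : ℝ))) * ((F x : ℝ) : ℂ) = ((G l : ℝ) : ℂ) := by
    intro l
    have h := congrArg (starRingEnd ℂ) (hG l)
    rw [← integral_conj, Complex.conj_ofReal] at h
    rw [← h]
    congr 1 with x
    rw [map_mul, ← Complex.exp_conj, map_mul, Complex.conj_I, Complex.conj_ofReal,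
      Complex.conj_ofReal, neg_mul]
  have hFF : Integrable (fun z : EuclideanSpace ℝ (Fin n) × EuclideanSpace ℝ (Fin n) =>
      ((F z.1 : ℝ) : ℂ) * ((F z.2 : ℝ) : ℂ)) (volume.prod volume) := hF.ofReal.mul_prod hF.ofReal
  have hint : Integrable (fun w : (EuclideanSpace ℝ (Fin n) × EuclideanSpace ℝ (Fin n)) ×
      EuclideanSpace ℝ (Fin n) => Complex.exp (Complex.I * (⟪w.2, w.1.1 - w.1.2⟫ : ℝ)) *
        ((((F w.1.1 : ℝ) : ℂ) * ((F w.1.2 : ℝ) : ℂ)) * ((φ ‖w.2‖ : ℝ) : ℂ)))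
      ((volume.prod volume).prod volume) := by
    refine Integrable.bdd_mul (c := 1) (hFF.mul_prod hB.integrable.ofReal)
      (Continuous.aestronglyMeasurable (by fun_prop)) (ae_of_all _ fun w => ?_)
    rw [mul_comm, Complex.norm_exp_ofReal_mul_I]
  apply Complex.ofReal_injective
  rw [← integral_complex_ofReal, ← integral_complex_ofReal]
  calc ∫ z : EuclideanSpace ℝ (Fin n) × EuclideanSpace ℝ (Fin n),
        (((F z.1 * F z.2) * B ‖z.1 - z.2‖ : ℝ) : ℂ) ∂(volume.prod volume)
      = ∫ z : EuclideanSpace ℝ (Fin n) × EuclideanSpace ℝ (Fin n), (∫ l,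
          Complex.exp (Complex.I * (⟪l, z.1 - z.2⟫ : ℝ)) *
          ((((F z.1 : ℝ) : ℂ) * ((F z.2 : ℝ) : ℂ)) * ((φ ‖l‖ : ℝ) : ℂ))) ∂(volume.prod volume) := by
        congr 1 with z
        push_cast
        rw [hB.covariance_eq, ← integral_const_mul]
        congr 1 with l
        ring
    _ = ∫ l, ∫ z : EuclideanSpace ℝ (Fin n) × EuclideanSpace ℝ (Fin n),
          Complex.exp (Complex.I * (⟪l, z.1 - z.2⟫ : ℝ)) *
          ((((F z.1 : ℝ) : ℂ) * ((F z.2 : ℝ) : ℂ)) * ((φ ‖l‖ : ℝ) : ℂ)) ∂(volume.prod volume) :=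
        integral_integral_swap hint
    _ = ∫ l : EuclideanSpace ℝ (Fin n), ((φ ‖l‖ * G l ^ 2 : ℝ) : ℂ) := by
        congr 1 with l
        push_cast
        rw [pow_two]
        nth_rewrite 1 [← hG l]
        rw [← hG' l, ← integral_prod_mul, ← integral_const_mul]
        congr 1 with z
        rw [inner_sub_right, Complex.ofReal_sub, mul_sub, sub_eq_add_neg, Complex.exp_add]
        ring

/-! ### Concentration of a spectral integral at a singular point -/

/-- Near `0` boundedness of `G` and `α > 0` suffice; at infinity the decay gives `u^{α-2}`,
integrable because `α < 1`. -/
lemma integrableOn_rpow_mul_sq {α M C : ℝ} (hα0 : 0 < α) (hα1 : α < 1) {G : ℝ → ℝ}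
    (hG : Continuous G) (hM : ∀ s, |G s| ≤ M) (hC : ∀ s, |s| * G s ^ 2 ≤ C) :
    IntegrableOn (fun u => u ^ (α - 1) * G u ^ 2) (Set.Ioi 0) := by
  have hm : ∀ S : Set ℝ, AEStronglyMeasurable (fun u => u ^ (α - 1) * G u ^ 2)
      (volume.restrict S) := fun S => by
    have : Measurable fun u => u ^ (α - 1) * G u ^ 2 := by fun_prop
    exact this.aestronglyMeasurable
  rw [← Set.Ioc_union_Ioi_eq_Ioi zero_le_one]
  refine IntegrableOn.union ?_ ?_
  · have h1 : IntegrableOn (fun u : ℝ => u ^ (α - 1)) (Set.Ioc 0 1) :=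
      (intervalIntegrable_iff_integrableOn_Ioc_of_le zero_le_one).1
        (intervalIntegral.intervalIntegrable_rpow' (by linarith))
    refine Integrable.mono' (h1.mul_const (M ^ 2)) (hm _) ?_
    refine (ae_restrict_mem measurableSet_Ioc).mono fun u hu => ?_
    have hu0 : 0 ≤ u ^ (α - 1) := Real.rpow_nonneg hu.1.le _
    rw [Real.norm_of_nonneg (by positivity)]
    exact mul_le_mul_of_nonneg_left (sq_le_sq' (abs_le.1 (hM u)).1 (abs_le.1 (hM u)).2) hu0
  · have h1 : IntegrableOn (fun u : ℝ => u ^ (α - 2)) (Set.Ioi 1) :=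
      integrableOn_Ioi_rpow_of_lt (by linarith) one_pos
    refine Integrable.mono' (h1.mul_const C) (hm _) ?_
    refine (ae_restrict_mem measurableSet_Ioi).mono fun u hu => ?_
    have hu0 : (0 : ℝ) < u := one_pos.trans hu
    rw [Real.norm_of_nonneg (by positivity)]
    have e : u ^ (α - 1) = u ^ (α - 2) * u := by
      rw [← Real.rpow_add_one hu0.ne']
      ring_nf
    rw [e, mul_assoc]
    have := hC u
    rw [abs_of_pos hu0] at this
    exact mul_le_mul_of_nonneg_left this (by positivity)

lemma integrable_abs_rpow_mul_sq {α M C : ℝ} (hα0 : 0 < α) (hα1 : α < 1) {G : ℝ → ℝ}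
    (hG : Continuous G) (heven : ∀ s, G (-s) = G s) (hM : ∀ s, |G s| ≤ M)
    (hC : ∀ s, |s| * G s ^ 2 ≤ C) :
    Integrable (fun u => |u| ^ (α - 1) * G u ^ 2) := by
  have h := (integrable_fun_norm_addHaar (volume : Measure ℝ)
    (f := fun u => u ^ (α - 1) * G u ^ 2)).2
      (by simpa using integrableOn_rpow_mul_sq hα0 hα1 hG hM hC)
  refine h.congr (ae_of_all _ fun u => ?_)
  rcases abs_choice u with hu | hu <;> simp [Real.norm_eq_abs, hu, heven]

/-- Off the ball `G(r(ρ - a))² ≤ C/(rδ)`, so the whole expression is `O(r^{α-1})`. -/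
lemma tendsto_rpow_mul_integral_far {α C δ a : ℝ} (hα1 : α < 1) (hδ : 0 < δ) {ψ G : ℝ → ℝ}
    (hψ : Integrable ψ) (hC : ∀ s, |s| * G s ^ 2 ≤ C) :
    Tendsto (fun r : ℝ => r ^ α * ∫ ρ, (Metric.ball a δ)ᶜ.indicator ψ ρ * G (r * (ρ - a)) ^ 2)
      atTop (𝓝 0) := by
  have hC0 : 0 ≤ C := le_trans (by positivity) (hC 0)
  have hlim : Tendsto (fun r : ℝ => r ^ (-(1 - α)) * (C / δ * ∫ ρ, ‖ψ ρ‖)) atTop (𝓝 0) := by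
    simpa using (tendsto_rpow_neg_atTop (sub_pos.2 hα1)).mul_const (C / δ * ∫ ρ, ‖ψ ρ‖)
  refine squeeze_zero_norm' ?_ hlim
  filter_upwards [eventually_gt_atTop 0] with r hr
  have hb : ‖∫ ρ, (Metric.ball a δ)ᶜ.indicator ψ ρ * G (r * (ρ - a)) ^ 2‖
      ≤ ∫ ρ, ‖ψ ρ‖ * (C / (r * δ)) := by
    refine norm_integral_le_of_norm_le (hψ.norm.mul_const _) (ae_of_all _ fun ρ => ?_)
    by_cases hρ : ρ ∈ Metric.ball a δ
    · simp only [Set.indicator_of_notMem (Set.notMem_compl_iff.2 hρ), zero_mul, norm_zero]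
      positivity
    · rw [Set.indicator_of_mem hρ, norm_mul]
      refine mul_le_mul_of_nonneg_left ?_ (norm_nonneg _)
      rw [Real.norm_of_nonneg (by positivity), le_div_iff₀ (by positivity)]
      have h1 : δ ≤ |ρ - a| := by simpa [Real.dist_eq] using hρ
      have h2 := hC (r * (ρ - a))
      rw [abs_mul, abs_of_pos hr] at h2
      have h3 : r * δ ≤ r * |ρ - a| := mul_le_mul_of_nonneg_left h1 hr.le
      nlinarith [sq_nonneg (G (r * (ρ - a)))]
  rw [norm_mul, Real.norm_of_nonneg (by positivity)]
  calc r ^ α * ‖∫ ρ, (Metric.ball a δ)ᶜ.indicator ψ ρ * G (r * (ρ - a)) ^ 2‖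
      ≤ r ^ α * ∫ ρ, ‖ψ ρ‖ * (C / (r * δ)) := mul_le_mul_of_nonneg_left hb (by positivity)
    _ = r ^ (-(1 - α)) * (C / δ * ∫ ρ, ‖ψ ρ‖) := by
      rw [integral_mul_const, neg_sub, Real.rpow_sub_one hr.ne']
      field_simp

/-- With `u = r(ρ - a)` the Jacobian gives `r^{-1}` and the singular factor `r^{1-α} |u|^{α-1}`,
which together cancel `r^α`. Dominated convergence applies with majorant `K |u|^{α-1} G(u)²`. -/
lemma tendsto_rpow_mul_integral_near {α M C δ a K : ℝ} (hα0 : 0 < α) (hα1 : α < 1) (hδ : 0 < δ)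
    {ψ κ G : ℝ → ℝ} (hψ : Integrable ψ) (hκ : ContinuousAt κ a)
    (hψκ : ∀ ρ ∈ Metric.ball a δ, ρ ≠ a → ψ ρ = |ρ - a| ^ (α - 1) * κ ρ)
    (hK : ∀ ρ ∈ Metric.ball a δ, |κ ρ| ≤ K)
    (hG : Continuous G) (heven : ∀ s, G (-s) = G s) (hM : ∀ s, |G s| ≤ M)
    (hC : ∀ s, |s| * G s ^ 2 ≤ C) :
    Tendsto (fun r : ℝ => r ^ α * ∫ ρ, (Metric.ball a δ).indicator ψ ρ * G (r * (ρ - a)) ^ 2)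
      atTop (𝓝 (κ a * ∫ u, |u| ^ (α - 1) * G u ^ 2)) := by
  have hsub : ∀ᶠ r : ℝ in atTop,
      ∫ u, r ^ (α - 1) * ((Metric.ball a δ).indicator ψ (a + r⁻¹ * u) * G u ^ 2)
        = r ^ α * ∫ ρ, (Metric.ball a δ).indicator ψ ρ * G (r * (ρ - a)) ^ 2 := by
    filter_upwards [eventually_gt_atTop 0] with r hr
    have h1 := integral_add_left_eq_self (μ := (volume : Measure ℝ))
      (fun ρ => (Metric.ball a δ).indicator ψ ρ * G (r * (ρ - a)) ^ 2) a
    have h2 := Measure.integral_comp_mul_left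
      (fun x => (Metric.ball a δ).indicator ψ (a + x) * G (r * (a + x - a)) ^ 2) r⁻¹
    rw [h1, inv_inv, abs_of_pos hr, smul_eq_mul] at h2
    rw [integral_const_mul, Real.rpow_sub_one hr.ne', div_mul_eq_mul_div, mul_div_assoc]
    congr 1
    rw [div_eq_iff hr.ne', mul_comm, ← h2]
    congr 1 with u
    rw [add_sub_cancel_left, mul_inv_cancel_left₀ hr.ne']
  refine Tendsto.congr' hsub ?_
  rw [← integral_const_mul]
  have hint := integrable_abs_rpow_mul_sq hα0 hα1 hG heven hM hC
  have key : ∀ r > 0, ∀ u ≠ 0, a + r⁻¹ * u ∈ Metric.ball a δ →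
      r ^ (α - 1) * ((Metric.ball a δ).indicator ψ (a + r⁻¹ * u) * G u ^ 2)
        = κ (a + r⁻¹ * u) * (|u| ^ (α - 1) * G u ^ 2) := by
    intro r hr u hu hmem
    have hne : a + r⁻¹ * u ≠ a := by simp [hu, hr.ne']
    rw [Set.indicator_of_mem hmem, hψκ _ hmem hne, add_sub_cancel_left, abs_mul,
      abs_of_pos (inv_pos.2 hr), Real.mul_rpow (inv_pos.2 hr).le (abs_nonneg u),
      Real.inv_rpow hr.le]
    have := (Real.rpow_pos_of_pos hr (α - 1)).ne'
    field_simp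
  have hne0 : ∀ᵐ u : ℝ, u ≠ 0 := by simp [ae_iff]
  refine tendsto_integral_filter_of_dominated_convergence
    (fun u => K * (|u| ^ (α - 1) * G u ^ 2)) ?_ ?_ (hint.const_mul K) ?_
  · filter_upwards [eventually_gt_atTop 0] with r hr
    have h1 := ((hψ.indicator Metric.isOpen_ball.measurableSet (s := Metric.ball a δ)).comp_add_left
      a).comp_mul_left' (inv_pos.2 hr).ne'
    exact (h1.1.mul (hG.pow 2).aestronglyMeasurable).const_mul _
  · filter_upwards [eventually_gt_atTop 0] with r hr
    filter_upwards [hne0] with u hu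
    by_cases hmem : a + r⁻¹ * u ∈ Metric.ball a δ
    · rw [key r hr u hu hmem, norm_mul, Real.norm_of_nonneg (r := |u| ^ (α - 1) * G u ^ 2)
        (by positivity)]
      exact mul_le_mul_of_nonneg_right (hK _ hmem) (by positivity)
    · rw [Set.indicator_of_notMem hmem]
      have hK0 : 0 ≤ K := (abs_nonneg _).trans (hK a (Metric.mem_ball_self hδ))
      simp only [zero_mul, mul_zero, norm_zero]
      positivity
  · filter_upwards [hne0] with u hu
    have hlim : Tendsto (fun r : ℝ => a + r⁻¹ * u) atTop (𝓝 a) := by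
      simpa using (tendsto_inv_atTop_zero.mul_const u).const_add a
    have h1 : Tendsto (fun r : ℝ => κ (a + r⁻¹ * u) * (|u| ^ (α - 1) * G u ^ 2)) atTop
        (𝓝 (κ a * (|u| ^ (α - 1) * G u ^ 2))) := (hκ.tendsto.comp hlim).mul_const _
    refine h1.congr' ?_
    filter_upwards [eventually_gt_atTop 0, hlim.eventually (Metric.ball_mem_nhds a hδ)]
      with r hr hmem
    exact (key r hr u hu hmem).symm

/-- If `ψ(ρ) = |ρ - a|^{α-1} κ(ρ)` near `a`, with `κ` continuous at `a`, then integrals of `ψ`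
against the rescaled kernels `G(r(ρ - a))²` are of the order `r^{-α}`. -/
lemma tendsto_rpow_mul_integral_mul_sq {α M C a : ℝ} (hα0 : 0 < α) (hα1 : α < 1)
    {ψ κ G : ℝ → ℝ} (hψ : Integrable ψ) (hκ : ContinuousAt κ a)
    (hψκ : ∀ᶠ ρ in 𝓝[≠] a, ψ ρ = |ρ - a| ^ (α - 1) * κ ρ)
    (hG : Continuous G) (heven : ∀ s, G (-s) = G s) (hM : ∀ s, |G s| ≤ M)
    (hC : ∀ s, |s| * G s ^ 2 ≤ C) :
    Tendsto (fun r : ℝ => r ^ α * ∫ ρ, ψ ρ * G (r * (ρ - a)) ^ 2) atTop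
      (𝓝 (κ a * ∫ u, |u| ^ (α - 1) * G u ^ 2)) := by
  have hK : ∀ᶠ ρ in 𝓝 a, |κ ρ| ≤ |κ a| + 1 := by
    filter_upwards [hκ.abs.eventually_lt_const (lt_add_one |κ a|)] with ρ h using h.le
  obtain ⟨δ, hδ, h⟩ := Metric.eventually_nhds_iff_ball.1
    ((eventually_nhdsWithin_iff.1 hψκ).and hK)
  have hnear := tendsto_rpow_mul_integral_near hα0 hα1 hδ hψ hκ (fun ρ hρ => (h ρ hρ).1)
    (fun ρ hρ => (h ρ hρ).2) hG heven hM hC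
  have hfar := tendsto_rpow_mul_integral_far (a := a) hα1 hδ hψ hC
  have := hnear.add hfar
  rw [add_zero] at this
  refine this.congr fun r => ?_
  rw [← mul_add, ← integral_add]
  · congr 1
    congr 1 with ρ
    rw [← add_mul, Set.indicator_self_add_compl_apply]
  all_goals
    refine Integrable.mul_bdd (c := M ^ 2) (hψ.indicator ?_) ?_ (ae_of_all _ fun ρ => ?_)
    · measurability
    · exact Continuous.aestronglyMeasurable (by fun_prop)
    · rw [Real.norm_of_nonneg (by positivity)]
      exact sq_le_sq' (abs_le.1 (hM _)).1 (abs_le.1 (hM _)).2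

/-! ### The radial density near the singular sphere of radius `a j` -/

namespace IsCyclicalDensity

variable {n k : ℕ} {a α : ℕ → ℝ} {h φ : ℝ → ℝ}

lemma a_pos (hφ : IsCyclicalDensity n k a α h φ) {j : ℕ} (hj : j ∈ Finset.Ico 1 k) :
    0 < a j := by
  rw [Finset.mem_Ico] at hj
  have := hφ.a_lt 0 j (by omega) hj.2
  rwa [hφ.a_zero] at this

lemma a_injective (hφ : IsCyclicalDensity n k a α h φ) {i j : ℕ} (hi : i < k) (hj : j < k)
    (hij : i ≠ j) : a i ≠ a j := by
  rcases lt_or_gt_of_ne hij with h1 | h1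
  · exact (hφ.a_lt i j h1 hj).ne
  · exact (hφ.a_lt j i h1 hi).ne'

lemma dim_pos (hφ : IsCyclicalDensity n k a α h φ) : 0 < n := by
  exact_mod_cast hφ.alpha_zero.1.trans hφ.alpha_zero.2

lemma h_pos (hφ : IsCyclicalDensity n k a α h φ) {j : ℕ} (hj : j ∈ Finset.Ico 1 k) :
    0 < h (a j) :=
  lt_of_le_of_ne (hφ.h_nonneg _ (hφ.a_pos hj).le) (hφ.h_ne_zero j (Finset.mem_Ico.1 hj).2).symm

lemma cyclicalConst_pos (hφ : IsCyclicalDensity n k a α h φ) {j : ℕ} (hj : j ∈ Finset.Ico 1 k) :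
    0 < cyclicalConst k a α j := by
  refine mul_pos (Real.rpow_pos_of_pos (hφ.a_pos hj) _) (Finset.prod_pos fun i hi => ?_)
  rw [Finset.mem_erase, Finset.mem_Ico] at hi
  exact Real.rpow_pos_of_pos (abs_pos.2 (sub_ne_zero.2
    (hφ.a_injective (Finset.mem_Ico.1 hj).2 hi.2.2 hi.1.symm))) _

/-- The radial density without its singular factor at `a j`. -/
noncomputable def regularFactor (n k : ℕ) (a α : ℕ → ℝ) (h : ℝ → ℝ) (j : ℕ) (ρ : ℝ) : ℝ :=
  ρ ^ (n - 1) * (h ρ / ρ ^ ((n : ℝ) - α 0) *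
    ∏ i ∈ (Finset.Ico 1 k).erase j, 1 / |ρ - a i| ^ (1 - α i))

lemma continuousAt_regularFactor (hφ : IsCyclicalDensity n k a α h φ) {j : ℕ}
    (hj : j ∈ Finset.Ico 1 k) : ContinuousAt (regularFactor n k a α h j) (a j) := by
  have ha := hφ.a_pos hj
  have hjk := (Finset.mem_Ico.1 hj).2
  have hh : ContinuousAt h (a j) := by
    obtain ⟨U, hU, hc⟩ := hφ.h_continuous j hjk
    -- Since `a j > 0`, one-sided neighbourhoods in `[0, ∞)` are full neighbourhoods.
    rw [nhdsWithin_eq_nhds.2 (Ici_mem_nhds ha)] at hU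
    exact hc.continuousAt hU
  refine (continuousAt_id.pow _).mul ((hh.div (Real.continuousAt_rpow_const _ _ (Or.inl ha.ne'))
    (Real.rpow_pos_of_pos ha _).ne').mul ?_)
  refine tendsto_finsetProd _ fun i hi => ?_
  rw [Finset.mem_erase, Finset.mem_Ico] at hi
  have hne : 0 < |a j - a i| := abs_pos.2 (sub_ne_zero.2 (hφ.a_injective hjk hi.2.2 hi.1.symm))
  have hcont : ContinuousAt (fun ρ => |ρ - a i|) (a j) := by fun_prop
  exact ContinuousAt.div continuousAt_const (hcont.rpow_const (Or.inl hne.ne'))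
    (Real.rpow_pos_of_pos hne _).ne'

/-- The Jacobian `ρ^{n-1}` against `ρ^{n-α₀}` leaves `a_j^{1-α₀}` in the denominator, which explains
the first factor of `cyclicalConst`. -/
lemma regularFactor_self (hφ : IsCyclicalDensity n k a α h φ) {j : ℕ}
    (hj : j ∈ Finset.Ico 1 k) :
    regularFactor n k a α h j (a j) = h (a j) / cyclicalConst k a α j := by
  have ha := hφ.a_pos hj
  have e : a j ^ ((n : ℝ) - α 0) = a j ^ (n - 1) * a j ^ (1 - α 0) := by
    rw [← Real.rpow_natCast, ← Real.rpow_add ha, Nat.cast_sub hφ.dim_pos]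
    congr 1
    push_cast
    ring
  have h1 : a j ^ (n - 1) ≠ 0 := (pow_pos ha _).ne'
  rw [regularFactor, cyclicalConst, e, Finset.prod_div_distrib, Finset.prod_const_one]
  field_simp

lemma eventually_eq_regularFactor (hφ : IsCyclicalDensity n k a α h φ) {j : ℕ}
    (hj : j ∈ Finset.Ico 1 k) :
    ∀ᶠ ρ in 𝓝[≠] a j, (Set.Ioi 0).indicator (fun y => y ^ (n - 1) * φ y) ρ
      = |ρ - a j| ^ (α j - 1) * regularFactor n k a α h j ρ := by
  have hjk := (Finset.mem_Ico.1 hj).2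
  have hev : ∀ᶠ ρ in 𝓝[≠] a j, ∀ i ∈ Finset.range k, ρ ≠ a i := by
    refine (Finset.eventually_all _).2 fun i hi => ?_
    rcases eq_or_ne i j with rfl | hij
    · exact self_mem_nhdsWithin
    · exact nhdsWithin_le_nhds
        (eventually_ne_nhds (hφ.a_injective (Finset.mem_range.1 hi) hjk hij).symm)
  filter_upwards [hev, nhdsWithin_le_nhds (eventually_gt_nhds (hφ.a_pos hj))] with ρ h1 h2
  rw [Set.indicator_of_mem (Set.mem_Ioi.2 h2),
    hφ.eq_formula ρ h2.le fun i hi => h1 i (Finset.mem_range.2 hi), regularFactor,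
    ← Finset.mul_prod_erase _ _ hj, ← neg_sub 1 (α j), Real.rpow_neg (abs_nonneg _)]
  ring

/-- Concentration of the spectral integral at the sphere of radius `a j`. -/
lemma tendsto_rpow_mul_integral (hφ : IsCyclicalDensity n k a α h φ) {j : ℕ}
    (hj : j ∈ Finset.Ico 1 k) {G : ℝ → ℝ} {M C : ℝ} (hG : Continuous G)
    (heven : ∀ s, G (-s) = G s) (hM : ∀ s, |G s| ≤ M) (hC : ∀ s, |s| * G s ^ 2 ≤ C) :
    Tendsto (fun r : ℝ => r ^ α j *
        ∫ l : EuclideanSpace ℝ (Fin n), φ ‖l‖ * G (r * (‖l‖ - a j)) ^ 2) atTop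
      (𝓝 (2 * h (a j) / cyclicalConst k a α j *
        ∫ u : EuclideanSpace ℝ (Fin n), ‖u‖ ^ (α j - n) * G ‖u‖ ^ 2)) := by
  have hn := hφ.dim_pos
  have : Nonempty (Fin n) := ⟨⟨0, hn⟩⟩
  have : Nontrivial (EuclideanSpace ℝ (Fin n)) := inferInstance
  obtain ⟨hα0, hα1⟩ := hφ.alpha_pos_lt j hj
  have hψ : Integrable ((Set.Ioi 0).indicator fun y => y ^ (n - 1) * φ y) := by
    rw [integrable_indicator_iff measurableSet_Ioi]
    simpa using (integrable_fun_norm_addHaar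
      (volume : Measure (EuclideanSpace ℝ (Fin n)))).1 hφ.integrable
  have h1 := tendsto_rpow_mul_integral_mul_sq hα0 hα1 hψ (hφ.continuousAt_regularFactor hj)
    (hφ.eventually_eq_regularFactor hj) hG heven hM hC
  have hl : ∀ r : ℝ, ∫ ρ, (Set.Ioi 0).indicator (fun y => y ^ (n - 1) * φ y) ρ *
      G (r * (ρ - a j)) ^ 2
      = ∫ y in Set.Ioi 0, y ^ (n - 1) * (φ y * G (r * (y - a j)) ^ 2) := by
    intro r
    rw [← integral_indicator measurableSet_Ioi]
    congr 1 with ρ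
    by_cases hρ : ρ ∈ Set.Ioi (0 : ℝ)
    · simp only [Set.indicator_of_mem hρ]
      ring
    · simp only [Set.indicator_of_notMem hρ, zero_mul]
  -- The inside and the outside of the sphere contribute equally, by evenness of `G`: this is the
  -- `2` of the normalization.
  have hr : ∫ u, |u| ^ (α j - 1) * G u ^ 2
      = 2 * ∫ y in Set.Ioi 0, y ^ (n - 1) * (y ^ (α j - n) * G y ^ 2) := by
    have e : ∀ u, |u| ^ (α j - 1) * G u ^ 2 = |u| ^ (α j - 1) * G |u| ^ 2 := fun u => by
      rcases abs_choice u with hu | hu <;> simp [hu, heven]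
    simp_rw [e]
    rw [integral_comp_abs (f := fun u => u ^ (α j - 1) * G u ^ 2)]
    congr 1
    refine setIntegral_congr_fun measurableSet_Ioi fun y hy => ?_
    have hy0 : (0 : ℝ) < y := hy
    have e2 : y ^ (α j - 1) = y ^ (n - 1) * y ^ (α j - n) := by
      rw [← Real.rpow_natCast, ← Real.rpow_add hy0, Nat.cast_sub hn]
      congr 1
      push_cast
      ring
    rw [e2, mul_assoc]
  simp_rw [hl] at h1
  rw [hr, hφ.regularFactor_self hj] at h1
  have h2 := h1.const_mul ((Module.finrank ℝ (EuclideanSpace ℝ (Fin n)) : ℝ) *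
    (volume : Measure (EuclideanSpace ℝ (Fin n))).real (Metric.ball 0 1))
  -- The constant is the surface area of the unit sphere; it occurs on both sides, so its value is
  -- irrelevant.
  have h3 : ∀ f : ℝ → ℝ, ∫ u : EuclideanSpace ℝ (Fin n), f ‖u‖
      = ((Module.finrank ℝ (EuclideanSpace ℝ (Fin n)) : ℝ) *
        (volume : Measure (EuclideanSpace ℝ (Fin n))).real (Metric.ball 0 1)) *
        ∫ y in Set.Ioi 0, y ^ (n - 1) * f y := by
    intro f
    rw [integral_fun_norm_addHaar]
    simp [mul_assoc]
  rw [h3 fun y => y ^ (α j - n) * G y ^ 2]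
  simp_rw [fun r : ℝ => h3 fun y => φ y * G (r * (y - a j)) ^ 2]
  simp_rw [mul_left_comm (_ ^ α j)]
  convert! h2 using 2
  ring

end IsCyclicalDensity

/-! ### Spectral kernels -/

/-- Bounded continuous even functions with `|s| G(s)²` bounded. -/
structure IsSpectralKernel (G : ℝ → ℝ) : Prop where
  continuous : Continuous G
  even : ∀ s, G (-s) = G s
  bounded : ∃ M, ∀ s, |G s| ≤ M
  decay : ∃ C, ∀ s, |s| * G s ^ 2 ≤ C

namespace IsSpectralKernel

variable {G H : ℝ → ℝ}

lemma zero : IsSpectralKernel fun _ => 0 :=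
  ⟨continuous_const, fun _ => rfl, ⟨0, by simp⟩, ⟨0, by simp⟩⟩

lemma add (hG : IsSpectralKernel G) (hH : IsSpectralKernel H) :
    IsSpectralKernel fun s => G s + H s := by
  obtain ⟨M, hM⟩ := hG.bounded
  obtain ⟨M', hM'⟩ := hH.bounded
  obtain ⟨C, hC⟩ := hG.decay
  obtain ⟨C', hC'⟩ := hH.decay
  refine ⟨hG.continuous.add hH.continuous, fun s => by rw [hG.even, hH.even],
    ⟨M + M', fun s => (abs_add_le _ _).trans (add_le_add (hM s) (hM' s))⟩,
    ⟨2 * (C + C'), fun s => ?_⟩⟩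
  -- `(G + H)² + (G - H)² = 2G² + 2H²`, whence the constant `2(C + C')`.
  nlinarith [hC s, hC' s, mul_nonneg (abs_nonneg s) (sq_nonneg (G s - H s))]

lemma const_mul (hG : IsSpectralKernel G) (b : ℝ) : IsSpectralKernel fun s => b * G s := by
  obtain ⟨M, hM⟩ := hG.bounded
  obtain ⟨C, hC⟩ := hG.decay
  refine ⟨continuous_const.mul hG.continuous, fun s => by rw [hG.even],
    ⟨|b| * M, fun s => ?_⟩, ⟨b ^ 2 * C, fun s => ?_⟩⟩
  · rw [abs_mul]
    exact mul_le_mul_of_nonneg_left (hM s) (abs_nonneg b)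
  · have := mul_le_mul_of_nonneg_left (hC s) (sq_nonneg b)
    linarith

lemma comp_mul_left (hG : IsSpectralKernel G) {t : ℝ} (ht : 0 < t) :
    IsSpectralKernel fun s => G (t * s) := by
  obtain ⟨M, hM⟩ := hG.bounded
  obtain ⟨C, hC⟩ := hG.decay
  refine ⟨hG.continuous.comp (continuous_const_mul t), fun s => by rw [mul_neg, hG.even],
    ⟨M, fun s => hM _⟩, ⟨C / t, fun s => ?_⟩⟩
  have := hC (t * s)
  rw [abs_mul, abs_of_pos ht] at this
  rw [le_div_iff₀ ht]
  linarith

lemma sum {ι : Type*} (I : Finset ι) {G : ι → ℝ → ℝ} (hG : ∀ i ∈ I, IsSpectralKernel (G i)) :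
    IsSpectralKernel fun s => ∑ i ∈ I, G i s := by
  classical
  induction I using Finset.induction_on with
  | empty => simpa using zero
  | insert i I hi ih =>
    simp_rw [Finset.sum_insert hi]
    exact (hG i (Finset.mem_insert_self i I)).add
      (ih fun k hk => hG k (Finset.mem_insert_of_mem hk))

end IsSpectralKernel

/-- `g(s)` is the Fourier transform of the integrable `f 1` at a vector of length `|s| + c`, hence
continuous and bounded in `s`. Lengths only reach arguments `≥ -c` of `g`, so evenness is used to
replace `s` by `|s|`. -/
lemma IsWeightFamily.isSpectralKernel {n : ℕ} (hn : 0 < n) {c : ℝ} (hc : 0 ≤ c)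
    {f : ℝ → EuclideanSpace ℝ (Fin n) → ℝ} {g : ℝ → ℝ} (hf : IsWeightFamily n c f g) :
    IsSpectralKernel g := by
  have hint : Integrable (f 1) := memLp_one_iff_integrable.1 (hf.memLp_one 1 one_pos)
  let e : EuclideanSpace ℝ (Fin n) := EuclideanSpace.single ⟨0, hn⟩ 1
  have hg : ∀ s, ((g s : ℝ) : ℂ) =
      ∫ x, Complex.exp (Complex.I * (⟪(|s| + c) • e, x⟫ : ℝ)) * ((f 1 x : ℝ) : ℂ) := by
    intro s
    have h1 : ‖(|s| + c) • e‖ = |s| + c := by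
      rw [norm_smul, Real.norm_of_nonneg (by positivity)]
      simp [e]
    have h2 := hf.fourier_eq 1 one_pos ((|s| + c) • e)
    rw [h1] at h2
    have h3 : g |s| = g s := by rcases abs_choice s with h | h <;> simp [h, hf.even]
    simp only [one_pow, div_one, add_sub_cancel_right, one_mul, h3] at h2
    exact h2.symm
  have hnorm : ∀ (s : ℝ) (x : EuclideanSpace ℝ (Fin n)),
      ‖Complex.exp (Complex.I * (⟪(|s| + c) • e, x⟫ : ℝ)) * ((f 1 x : ℝ) : ℂ)‖ = ‖f 1 x‖ := by
    intro s x
    rw [norm_mul, mul_comm Complex.I, Complex.norm_exp_ofReal_mul_I, one_mul, Complex.norm_real]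
  refine ⟨?_, hf.even, ⟨∫ x, ‖f 1 x‖, fun s => ?_⟩, ?_⟩
  · have hcont : Continuous fun s => ((g s : ℝ) : ℂ) := by
      simp_rw [hg]
      refine continuous_of_dominated (bound := fun x => ‖f 1 x‖) (fun s => ?_)
        (fun s => ae_of_all _ fun x => (hnorm s x).le) hint.norm (ae_of_all _ fun x => by fun_prop)
      exact (Continuous.aestronglyMeasurable (by fun_prop)).mul hint.ofReal.1
    exact Complex.continuous_re.comp hcont
  · rw [← Real.norm_eq_abs, ← Complex.norm_real, hg]
    exact (norm_integral_le_integral_norm _).trans (by simp_rw [hnorm]; exact le_rfl)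
  · obtain ⟨C, hC⟩ := hf.decay
    refine ⟨C, fun s => ?_⟩
    rcases eq_or_ne s 0 with rfl | hs
    · have := hC 1 one_pos
      simp only [abs_zero, zero_mul]
      nlinarith [sq_nonneg (g 1)]
    · have h1 := hC |s| (abs_pos.2 hs)
      have h3 : g |s| = g s := by rcases abs_choice s with h | h <;> simp [h, hf.even]
      rw [h3, le_div_iff₀ (abs_pos.2 hs)] at h1
      linarith

lemma limitKernel_sq (n : ℕ) (β : ℝ) (g : ℝ → ℝ) (t : ℝ) (u : EuclideanSpace ℝ (Fin n)) :
    limitKernel n β g t u ^ 2 = ‖u‖ ^ (β - n) * g (t * ‖u‖) ^ 2 := by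
  rw [limitKernel, div_pow, ← Real.rpow_mul_natCast (norm_nonneg u), mul_comm ‖u‖ t,
    ← neg_sub (n : ℝ) β, Real.rpow_neg (norm_nonneg u)]
  push_cast
  rw [div_mul_cancel₀ _ (two_ne_zero)]
  ring

/-- In polar coordinates the Jacobian turns `y^{β-n}` into `y^{β-1}`, the one-dimensional case
already treated. -/
lemma memLp_limitKernel {n : ℕ} (hn : 0 < n) {β : ℝ} (hβ0 : 0 < β) (hβ1 : β < 1) {G : ℝ → ℝ}
    (hG : IsSpectralKernel G) {t : ℝ} (ht : 0 < t) : MemLp (limitKernel n β G t) 2 volume := by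
  have : Nonempty (Fin n) := ⟨⟨0, hn⟩⟩
  have : Nontrivial (EuclideanSpace ℝ (Fin n)) := inferInstance
  have hm : Measurable (limitKernel n β G t) := by
    have := hG.continuous.measurable
    unfold limitKernel
    fun_prop
  rw [memLp_two_iff_integrable_sq hm.aestronglyMeasurable]
  simp_rw [limitKernel_sq]
  have hGt := hG.comp_mul_left ht
  obtain ⟨M, hM⟩ := hGt.bounded
  obtain ⟨C, hC⟩ := hGt.decay
  refine (integrable_fun_norm_addHaar (volume : Measure (EuclideanSpace ℝ (Fin n)))
    (f := fun y => y ^ (β - n) * G (t * y) ^ 2)).2 ?_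
  refine (integrableOn_rpow_mul_sq hβ0 hβ1 hGt.continuous hM hC).congr_fun (fun y hy => ?_)
    measurableSet_Ioi
  have hy0 : (0 : ℝ) < y := hy
  have e : y ^ (β - 1) = y ^ (n - 1) * y ^ (β - n) := by
    rw [← Real.rpow_natCast, ← Real.rpow_add hy0, Nat.cast_sub hn]
    congr 1
    push_cast
    ring
  simp [e, mul_assoc]

/-! ### Characteristic functions of the two integrals -/

lemma IsWhiteNoise.integralL2_mem {X Ω : Type*} [MeasurableSpace X] {μ : Measure X}
    [MeasurableSpace Ω] {Z : FinMeasSet μ → Ω → ℝ} {P : Measure Ω} (hZ : IsWhiteNoise μ Z P)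
    (K : Lp ℝ 2 μ) :
    hZ.integralL2 K ∈
      (Submodule.span ℝ (Set.range fun A => (hZ.memLp A).toLp (Z A))).topologicalClosure := by
  refine (IsWhiteNoise.denseRange_indicatorComb μ).induction_on
    (p := fun K => hZ.integralL2 K ∈ (Submodule.span ℝ
      (Set.range fun A => (hZ.memLp A).toLp (Z A))).topologicalClosure) K ?_ fun c => ?_
  · exact (Submodule.isClosed_topologicalClosure _).preimage hZ.integralL2.continuous
  · have h := LinearMap.extendOfNorm_eq (f := hZ.noiseComb)
      (IsWhiteNoise.denseRange_indicatorComb μ) ⟨1, fun c => by rw [hZ.norm_noiseComb, one_mul]⟩ c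
    rw [IsWhiteNoise.integralL2, h]
    exact Submodule.le_topologicalClosure _ (Finsupp.mem_span_range_iff_exists_finsupp.2 ⟨c, rfl⟩)

lemma IsWhiteNoise.integral_cexp_integralL2 {X Ω : Type*} [MeasurableSpace X] {μ : Measure X}
    [MeasurableSpace Ω] {Z : FinMeasSet μ → Ω → ℝ} {P : Measure Ω} [IsProbabilityMeasure P]
    (hZ : IsWhiteNoise μ Z P) {K : X → ℝ} (hK : MemLp K 2 μ) :
    ∫ ω, Complex.exp (Complex.I * (hZ.integralL2 (hK.toLp K) ω : ℂ)) ∂P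
      = Complex.exp (-(((∫ x, K x ^ 2 ∂μ) / 2 : ℝ) : ℂ)) := by
  rw [integral_cexp_of_mem_closure_span hZ.gaussian hZ.mean_zero hZ.memLp (hZ.integralL2_mem _),
    hZ.norm_integralL2, ← real_inner_self_eq_norm_sq, L2.inner_def]
  congr 4
  refine integral_congr_ae ?_
  filter_upwards [hK.coeFn_toLp] with x hx
  rw [hx]
  simp [pow_two]

lemma IsIsotropicGaussianField.integral_cexp_integral_mul {n : ℕ} {Ω : Type*}
    [MeasurableSpace Ω] {P : Measure Ω} [IsProbabilityMeasure P]
    {ξ : EuclideanSpace ℝ (Fin n) → Ω → ℝ} {B φ : ℝ → ℝ} (hξ : IsIsotropicGaussianField ξ B P)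
    (hB : HasIsotropicSpectralDensity n B φ) {F : EuclideanSpace ℝ (Fin n) → ℝ}
    (hF : Integrable F volume) {G : EuclideanSpace ℝ (Fin n) → ℝ}
    (hG : ∀ l : EuclideanSpace ℝ (Fin n),
      ∫ x, Complex.exp (Complex.I * (⟪l, x⟫ : ℝ)) * ((F x : ℝ) : ℂ) = ((G l : ℝ) : ℂ)) :
    ∫ ω, Complex.exp (Complex.I * ((∫ x, F x * ξ x ω : ℝ) : ℂ)) ∂P
      = Complex.exp (-(((∫ l : EuclideanSpace ℝ (Fin n), φ ‖l‖ * G l ^ 2) / 2 : ℝ) : ℂ)) := by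
  have hY := hξ.memLp_integral_mul hF
  rw [← hB.integral_mul_mul hF hG, ← hξ.integral_sq_integral_mul hF]
  have h1 : ‖hY.toLp _‖ ^ 2 = ∫ ω, (∫ x, F x * ξ x ω) ^ 2 ∂P := by
    rw [← real_inner_self_eq_norm_sq, L2.inner_def]
    refine integral_congr_ae ?_
    filter_upwards [hY.coeFn_toLp] with x hx
    rw [hx]
    simp [pow_two]
  rw [← h1, ← integral_cexp_of_mem_closure_span hξ.gaussian hξ.mean_zero hξ.memLp
    (hξ.toLp_integral_mul_mem hF)]
  refine integral_congr_ae ?_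
  filter_upwards [hY.coeFn_toLp] with x hx
  rw [hx]

/-! ### The two processes -/

/-- The linear combination `∑ c_i t_iⁿ g(t_i s)` of rescaled kernels. -/
noncomputable def combKernel (n : ℕ) {m : ℕ} (g : ℝ → ℝ) (t c : Fin m → ℝ) (s : ℝ) : ℝ :=
  ∑ i, c i * (t i ^ n * g (t i * s))

lemma IsSpectralKernel.combKernel {n : ℕ} (hn : 0 < n) {m : ℕ} {g : ℝ → ℝ}
    (hg : IsSpectralKernel g) {t : Fin m → ℝ} (ht : ∀ i, 0 ≤ t i) (c : Fin m → ℝ) :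
    IsSpectralKernel (combKernel n g t c) := by
  refine IsSpectralKernel.sum Finset.univ fun i _ => IsSpectralKernel.const_mul ?_ (c i)
  rcases (ht i).eq_or_lt with h | h
  -- At `t_i = 0` the factor `0 ^ n` vanishes because `n > 0`, in accordance with the value `0` of
  -- both processes at time `0`.
  · simpa [← h, hn.ne'] using IsSpectralKernel.zero
  · exact (hg.comp_mul_left h).const_mul _

/-- The kernel of the limit process, extended by `0` to `t = 0`. -/
lemma memLp_pow_mul_limitKernel {n : ℕ} (hn : 0 < n) {β : ℝ} (hβ0 : 0 < β) (hβ1 : β < 1)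
    {g : ℝ → ℝ} (hg : IsSpectralKernel g) {t : ℝ} (ht : 0 ≤ t) :
    MemLp (fun u => t ^ n * limitKernel n β g t u) 2 volume := by
  rcases ht.eq_or_lt with h | h
  · simp [← h, hn.ne']
  · exact (memLp_limitKernel hn hβ0 hβ1 hg h).const_mul _

lemma limitProcess_ae_eq {n : ℕ} (hn : 0 < n) {Ω : Type*} [MeasurableSpace Ω] {P : Measure Ω}
    {Z : FinMeasSet (volume : Measure (EuclideanSpace ℝ (Fin n))) → Ω → ℝ}
    (hZ : IsWhiteNoise volume Z P) {β : ℝ} (hβ0 : 0 < β) (hβ1 : β < 1)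
    {g : ℝ → ℝ} (hg : IsSpectralKernel g) {t : ℝ} (ht : 0 ≤ t) :
    limitProcess hZ β g t
      =ᵐ[P] hZ.integralL2 ((memLp_pow_mul_limitKernel hn hβ0 hβ1 hg ht).toLp _) := by
  rcases ht.eq_or_lt with h | h
  · subst h
    have h0 : (memLp_pow_mul_limitKernel hn hβ0 hβ1 hg le_rfl).toLp _ = 0 := by
      rw [Lp.eq_zero_iff_ae_eq_zero]
      refine (MemLp.coeFn_toLp _).trans ?_
      exact ae_of_all _ fun u => by simp [hn.ne']
    rw [h0, map_zero]
    filter_upwards [Lp.coeFn_zero ℝ 2 P] with ω hω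
    rw [hω]
    simp [limitProcess]
  · have hK := memLp_limitKernel hn hβ0 hβ1 hg h
    have h0 : (memLp_pow_mul_limitKernel hn hβ0 hβ1 hg ht).toLp _ = t ^ n • hK.toLp _ :=
      MemLp.toLp_const_smul (t ^ n) hK
    rw [h0, map_smul]
    filter_upwards [Lp.coeFn_smul (t ^ n) (hZ.integralL2 (hK.toLp _))] with ω hω
    rw [hω, limitProcess, if_neg h.ne', IsWhiteNoise.integral, dif_pos hK]
    rfl

lemma integral_cexp_limitProcess {n : ℕ} (hn : 0 < n) {Ω : Type*} [MeasurableSpace Ω]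
    {P : Measure Ω} [IsProbabilityMeasure P]
    {Z : FinMeasSet (volume : Measure (EuclideanSpace ℝ (Fin n))) → Ω → ℝ}
    (hZ : IsWhiteNoise volume Z P) {β : ℝ} (hβ0 : 0 < β) (hβ1 : β < 1)
    {g : ℝ → ℝ} (hg : IsSpectralKernel g) {m : ℕ} {t : Fin m → ℝ} (ht : ∀ i, 0 ≤ t i)
    (c : Fin m → ℝ) :
    ∫ ω, Complex.exp (Complex.I * ((∑ i, c i * limitProcess hZ β g (t i) ω : ℝ) : ℂ)) ∂P
      = Complex.exp (-(((∫ u : EuclideanSpace ℝ (Fin n),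
        ‖u‖ ^ (β - n) * combKernel n g t c ‖u‖ ^ 2) / 2 : ℝ) : ℂ)) := by
  have hK := fun i => memLp_pow_mul_limitKernel hn hβ0 hβ1 hg (ht i)
  -- The limit kernel of `combKernel` at time `1` is the combination of the individual kernels, so a
  -- single Wiener integral represents the whole sum.
  have hG := memLp_limitKernel hn hβ0 hβ1 (hg.combKernel hn ht c) one_pos
  have hsum : hG.toLp _ = ∑ i, c i • (hK i).toLp _ := by
    ext1
    have h1 : ∀ᵐ u, ∀ i, (c i • (hK i).toLp _ : Lp ℝ 2 volume) u
        = c i * (t i ^ n * limitKernel n β g (t i) u) := by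
      refine ae_all_iff.2 fun i => ?_
      filter_upwards [Lp.coeFn_smul (c i) ((hK i).toLp _), (hK i).coeFn_toLp] with u h1 h2
      rw [h1, Pi.smul_apply, h2, smul_eq_mul]
    filter_upwards [hG.coeFn_toLp, h1, Lp.coeFn_finsetSum Finset.univ fun i => c i • (hK i).toLp _]
      with u h2 h3 h4
    rw [h2, h4, Finset.sum_apply]
    simp_rw [h3]
    rw [limitKernel, combKernel, Finset.sum_div]
    refine Finset.sum_congr rfl fun i _ => ?_
    rw [limitKernel, mul_one, mul_comm ‖u‖ (t i)]
    ring
  have hcf := hZ.integral_cexp_integralL2 hG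
  simp_rw [limitKernel_sq, one_mul] at hcf
  rw [← hcf, hsum]
  simp_rw [map_sum, map_smul]
  have h1 : ∀ᵐ ω ∂P, ∀ i, (c i • hZ.integralL2 ((hK i).toLp _) : Lp ℝ 2 P) ω
      = c i * limitProcess hZ β g (t i) ω := by
    refine ae_all_iff.2 fun i => ?_
    filter_upwards [Lp.coeFn_smul (c i) (hZ.integralL2 ((hK i).toLp _)),
      limitProcess_ae_eq hn hZ hβ0 hβ1 hg (ht i)] with ω h1 h2
    rw [h1, Pi.smul_apply, h2, smul_eq_mul]
  refine integral_congr_ae ?_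
  filter_upwards [h1,
    Lp.coeFn_finsetSum Finset.univ fun i => c i • hZ.integralL2 ((hK i).toLp _)] with ω h2 h3
  rw [h3, Finset.sum_apply]
  simp_rw [h2]

section Prelimit

variable {n : ℕ} {Ω : Type*} {ξ : EuclideanSpace ℝ (Fin n) → Ω → ℝ}
  {f : ℝ → EuclideanSpace ℝ (Fin n) → ℝ}

/-- The weight of the prelimit process, extended by `0` to `t = 0`. -/
noncomputable def prelimitWeight (V hc β : ℝ) (f : ℝ → EuclideanSpace ℝ (Fin n) → ℝ) (r t : ℝ)
    (x : EuclideanSpace ℝ (Fin n)) : ℝ :=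
  if t = 0 then 0 else √V / (√(2 * hc) * r ^ ((n : ℝ) - β / 2)) * f (r * t) x

lemma prelimitProcess_eq_integral (V hc β : ℝ) (r t : ℝ) (ω : Ω) :
    prelimitProcess V hc β f ξ r t ω = ∫ x, prelimitWeight V hc β f r t x * ξ x ω := by
  rw [prelimitProcess]
  split_ifs with h
  · simp [prelimitWeight, h]
  · simp only [prelimitWeight, if_neg h, mul_assoc, integral_const_mul]

lemma IsWeightFamily.integrable {c : ℝ} {g : ℝ → ℝ} (hf : IsWeightFamily n c f g) {r : ℝ}
    (hr : 0 < r) : Integrable (f r) volume :=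
  memLp_one_iff_integrable.1 (hf.memLp_one r hr)

lemma IsWeightFamily.integrable_prelimitWeight {c : ℝ} {g : ℝ → ℝ} (hf : IsWeightFamily n c f g)
    (V hc β : ℝ) {r t : ℝ} (hr : 0 < r) (ht : 0 ≤ t) :
    Integrable (prelimitWeight V hc β f r t) volume := by
  unfold prelimitWeight
  rcases ht.eq_or_lt with h | h
  · simp [← h]
  · simpa only [if_neg h.ne'] using (hf.integrable (mul_pos hr h)).const_mul _

lemma integrable_cexp_inner_mul {F : EuclideanSpace ℝ (Fin n) → ℝ} (hF : Integrable F volume)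
    (l : EuclideanSpace ℝ (Fin n)) :
    Integrable (fun x => Complex.exp (Complex.I * (⟪l, x⟫ : ℝ)) * ((F x : ℝ) : ℂ)) volume := by
  refine hF.ofReal.bdd_mul (c := 1) (Continuous.aestronglyMeasurable (by fun_prop))
    (ae_of_all _ fun x => ?_)
  rw [mul_comm, Complex.norm_exp_ofReal_mul_I]

/-- The hypothesis at scale `rt` normalizes by `(rt)^{-n}`; this produces `r ^ n` and the `t ^ n` of
the limit. -/
lemma IsWeightFamily.fourier_prelimitWeight (hn : 0 < n) {c : ℝ} {g : ℝ → ℝ}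
    (hf : IsWeightFamily n c f g) (V hc β : ℝ) {r t : ℝ} (hr : 0 < r) (ht : 0 ≤ t)
    (l : EuclideanSpace ℝ (Fin n)) :
    ∫ x, Complex.exp (Complex.I * (⟪l, x⟫ : ℝ)) * ((prelimitWeight V hc β f r t x : ℝ) : ℂ)
      = ((√V / (√(2 * hc) * r ^ ((n : ℝ) - β / 2)) * r ^ n *
        (t ^ n * g (t * (r * (‖l‖ - c)))) : ℝ) : ℂ) := by
  rcases ht.eq_or_lt with h | h
  · simp [prelimitWeight, ← h, hn.ne']
  · have hrt : 0 < r * t := mul_pos hr h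
    have h1 := hf.fourier_eq (r * t) hrt l
    rw [← mul_assoc t r, mul_comm t r]
    push_cast
    rw [← h1, ← mul_assoc, ← integral_const_mul]
    congr 1 with x
    rw [prelimitWeight, if_neg h.ne']
    have hr' : (r : ℂ) ≠ 0 := by exact_mod_cast hr.ne'
    have ht' : (t : ℂ) ≠ 0 := by exact_mod_cast h.ne'
    push_cast
    rw [mul_pow]
    field_simp

variable [MeasurableSpace Ω] {P : Measure Ω} [IsProbabilityMeasure P]

lemma integral_cexp_prelimitProcess (hn : 0 < n) {B φ : ℝ → ℝ}
    (hξ : IsIsotropicGaussianField ξ B P) (hB : HasIsotropicSpectralDensity n B φ) {a : ℝ}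
    {g : ℝ → ℝ} (hf : IsWeightFamily n a f g) {V hc : ℝ} (hV : 0 < V) (hhc : 0 < hc) (β : ℝ)
    {m : ℕ} {t : Fin m → ℝ} (ht : ∀ i, 0 ≤ t i) (c : Fin m → ℝ) {r : ℝ} (hr : 0 < r) :
    ∫ ω, Complex.exp (Complex.I *
        ((∑ i, c i * prelimitProcess V hc β f ξ r (t i) ω : ℝ) : ℂ)) ∂P
      = Complex.exp (-(((V / (2 * hc) * (r ^ β * ∫ l : EuclideanSpace ℝ (Fin n),
        φ ‖l‖ * combKernel n g t c (r * (‖l‖ - a)) ^ 2)) / 2 : ℝ) : ℂ)) := by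
  have hw := fun i => hf.integrable_prelimitWeight V hc β hr (ht i)
  have hF : Integrable (fun x => ∑ i, c i * prelimitWeight V hc β f r (t i) x) volume :=
    integrable_finsetSum _ fun i _ => (hw i).const_mul (c i)
  have hG : ∀ l : EuclideanSpace ℝ (Fin n), ∫ x, Complex.exp (Complex.I * (⟪l, x⟫ : ℝ)) *
      ((∑ i, c i * prelimitWeight V hc β f r (t i) x : ℝ) : ℂ)
      = ((√V / (√(2 * hc) * r ^ ((n : ℝ) - β / 2)) * r ^ n *
        combKernel n g t c (r * (‖l‖ - a)) : ℝ) : ℂ) := by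
    intro l
    have e : ∀ x, Complex.exp (Complex.I * (⟪l, x⟫ : ℝ)) *
        ((∑ i, c i * prelimitWeight V hc β f r (t i) x : ℝ) : ℂ)
        = ∑ i, (c i : ℂ) * (Complex.exp (Complex.I * (⟪l, x⟫ : ℝ)) *
          ((prelimitWeight V hc β f r (t i) x : ℝ) : ℂ)) := by
      intro x
      rw [Complex.ofReal_sum, Finset.mul_sum]
      refine Finset.sum_congr rfl fun i _ => ?_
      rw [Complex.ofReal_mul]
      ring
    simp_rw [e]
    rw [integral_finsetSum _ fun i _ => (integrable_cexp_inner_mul (hw i) l).const_mul _,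
      combKernel, Finset.mul_sum, Complex.ofReal_sum]
    refine Finset.sum_congr rfl fun i _ => ?_
    rw [integral_const_mul, hf.fourier_prelimitWeight hn V hc β hr (ht i), ← Complex.ofReal_mul]
    congr 1
    ring
  have hcf := hξ.integral_cexp_integral_mul hB hF hG
  have hconst : (√V / (√(2 * hc) * r ^ ((n : ℝ) - β / 2)) * r ^ n) ^ 2
      = V / (2 * hc) * r ^ β := by
    -- The prefactor `r^{-(n-β/2)}` against `r ^ n` leaves `r^{β/2}`, whose square is the rate `r^β`
    -- of concentration.
    have h1 : r ^ β * (r ^ ((n : ℝ) - β / 2)) ^ 2 = (r ^ n) ^ 2 := by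
      rw [← Real.rpow_mul_natCast hr.le, ← Real.rpow_add hr, ← Real.rpow_natCast r n,
        ← Real.rpow_mul_natCast hr.le]
      congr 1
      push_cast
      ring
    have h2 : 0 < r ^ ((n : ℝ) - β / 2) := Real.rpow_pos_of_pos hr _
    rw [mul_pow, div_pow, mul_pow, Real.sq_sqrt hV.le, Real.sq_sqrt (by positivity), ← h1]
    field_simp
  have hvar : ∫ l : EuclideanSpace ℝ (Fin n), φ ‖l‖ *
      (√V / (√(2 * hc) * r ^ ((n : ℝ) - β / 2)) * r ^ n *
        combKernel n g t c (r * (‖l‖ - a))) ^ 2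
      = V / (2 * hc) * (r ^ β * ∫ l : EuclideanSpace ℝ (Fin n),
        φ ‖l‖ * combKernel n g t c (r * (‖l‖ - a)) ^ 2) := by
    simp_rw [mul_pow _ (combKernel n g t c _), hconst]
    rw [← mul_assoc, ← integral_const_mul]
    congr 1 with l
    ring
  rw [← hvar, ← hcf]
  refine integral_congr_ae ?_
  -- Exchanging the finite sum with the integral over `x` needs integrable paths, available almost
  -- surely.
  filter_upwards [ae_all_iff.2 fun i => hξ.ae_integrable_mul (hw i)] with ω hω
  congr 3
  simp_rw [Finset.sum_mul, mul_assoc]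
  rw [integral_finsetSum _ fun i _ => (hω i).const_mul (c i)]
  simp_rw [integral_const_mul, prelimitProcess_eq_integral]

end Prelimit

/-! ### The limit theorem -/

theorem theorem1
    (n k : ℕ) (a α : ℕ → ℝ) (h φ B : ℝ → ℝ)
    (hφ : IsCyclicalDensity n k a α h φ)
    {Ω : Type*} [MeasurableSpace Ω] (P : Measure Ω) [IsProbabilityMeasure P]
    (ξ : EuclideanSpace ℝ (Fin n) → Ω → ℝ)
    (hξ : IsIsotropicGaussianField ξ B P)
    (hB : HasIsotropicSpectralDensity n B φ)
    (j : ℕ) (hj : j ∈ Finset.Ico 1 k)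
    (f : ℝ → EuclideanSpace ℝ (Fin n) → ℝ) (g : ℝ → ℝ)
    (hf : IsWeightFamily n (a j) f g)
    {Ω' : Type*} [MeasurableSpace Ω'] (P' : Measure Ω') [IsProbabilityMeasure P']
    (Z : FinMeasSet (volume : Measure (EuclideanSpace ℝ (Fin n))) → Ω' → ℝ)
    (hZ : IsWhiteNoise volume Z P') :
    -- the integrals that define the two processes are meaningful
    (∀ r, 0 < r → ∀ᵐ ω ∂P, Integrable (fun x => f r x * ξ x ω) volume) ∧
    (∀ t ∈ Set.Ioc (0 : ℝ) 1, MemLp (limitKernel n (α j) g t) 2 volume) ∧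
    -- weak convergence of all finite-dimensional distributions as `r → ∞`
    (∀ (m : ℕ) (t : Fin m → ℝ), (∀ i, t i ∈ Set.Icc (0 : ℝ) 1) →
      TendstoInDistribution
        (fun (r : Set.Ioi (0 : ℝ)) (ω : Ω) (i : Fin m) =>
          prelimitProcess (cyclicalConst k a α j) (h (a j)) (α j) f ξ r (t i) ω)
        atTop
        (fun (ω : Ω') (i : Fin m) => limitProcess hZ (α j) g (t i) ω)
        (fun _ => P) P') := by
  have hn := hφ.dim_pos
  have hg := hf.isSpectralKernel hn (hφ.a_pos hj).le
  obtain ⟨hβ0, hβ1⟩ := hφ.alpha_pos_lt j hj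
  have hh := hφ.h_pos hj
  have hV := hφ.cyclicalConst_pos hj
  refine ⟨fun r hr => hξ.ae_integrable_mul (hf.integrable hr),
    fun t ht => memLp_limitKernel hn hβ0 hβ1 hg ht.1, fun m t ht => ?_⟩
  have ht0 : ∀ i, 0 ≤ t i := fun i => (ht i).1
  have : (atTop : Filter (Set.Ioi (0 : ℝ))).IsCountablyGenerated := by
    rw [atTop_Ioi_eq]
    infer_instance
  refine tendstoInDistribution_of_tendsto_integral_cexp (fun r => ?_) ?_ fun c => ?_
  · refine aemeasurable_pi_iff.2 fun i => ?_
    simp_rw [prelimitProcess_eq_integral]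
    exact (hξ.memLp_integral_mul (hf.integrable_prelimitWeight _ _ _ r.2 (ht0 i))).1.aemeasurable
  · refine aemeasurable_pi_iff.2 fun i => ?_
    exact (Lp.memLp _).1.aemeasurable.congr
      (limitProcess_ae_eq hn hZ hβ0 hβ1 hg (ht0 i)).symm
  · rw [integral_cexp_limitProcess hn hZ hβ0 hβ1 hg ht0 c]
    simp_rw [fun r : Set.Ioi (0 : ℝ) =>
      integral_cexp_prelimitProcess hn hξ hB hf hV hh (α j) ht0 c r.2]
    have hG := hg.combKernel hn ht0 c
    obtain ⟨M, hM⟩ := hG.bounded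
    obtain ⟨C, hC⟩ := hG.decay
    have hlim := ((hφ.tendsto_rpow_mul_integral hj hG.continuous hG.even hM hC).const_mul
      (cyclicalConst k a α j / (2 * h (a j)))).comp
      (tendsto_comp_val_Ioi_atTop (a := (0 : ℝ)).2 tendsto_id)
    -- The normalizing constant is exactly the inverse of the constant in the concentration limit.
    have e : cyclicalConst k a α j / (2 * h (a j)) * (2 * h (a j) / cyclicalConst k a α j *
        ∫ u : EuclideanSpace ℝ (Fin n), ‖u‖ ^ (α j - n) * combKernel n g t c ‖u‖ ^ 2)
        = ∫ u : EuclideanSpace ℝ (Fin n), ‖u‖ ^ (α j - n) * combKernel n g t c ‖u‖ ^ 2 := by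
      field_simp
    rw [e] at hlim
    have hcont : Continuous fun v : ℝ => Complex.exp (-((v / 2 : ℝ) : ℂ)) := by fun_prop
    exact (hcont.tendsto _).comp hlim
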